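/- For $x\in\mathbb R$ let $h(x)=\cos^{-1}(\tanh x)\in(0,\pi)$. For $L>0$ let $c(L)$ be the unique real number $x$ with $h'(x)=\frac{h(x)-h(x-L)}{L}$, and put $G(L)=h(c(L)-L)-h(c(L))$. A (unit-speed) piecewise geodesic $\gamma:\mathbb R\to\mathbb H^3$ is a continuous map for which there is a closed discrete set $T\subset\mathbb R$ such that $\gamma$ is a unit-speed geodesic arc on every open interval disjoint from $T$. Its bending angle at $t$ is the angle between the one-sided velocities $\gamma'_-(t)$ and $\gamma'_+(t)$, and $\|\gamma\|_L$ denotes the supremum over $a\in\mathbb R$ of the sum of the bending angles of $\gamma$ in $(a,a+L)$. A finite-leaved measured lamination $\mu$ on $\mathbb H^2$ is a finite set of pairwise disjoint complete geodesics (leaves) $l$, each with a mass $\mu(l)>0$. $\|\mu\|_L$ denotes the supremum, over all open geodesic arcs $\alpha$ of length $L$ in $\mathbb H^2$, of the total mass of the leaves that meet $\alpha$ transversely. The pleated plane $P_\mu:\mathbb H^2\to\mathbb H^3$, well defined up to post-composition with an isometry of $\mathbb H^3$, is the map that is a totally geodesic isometric embedding on the closure of each complementary region of the leaves and is bent, always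 towards the same side, by the angle $\mu(l)$ along each leaf $l$. A map $f$ into $\mathbb H^3$ is $K$-bilipschitz if $K^{-1}d(x,y)\le d(f(x),f(y))\le K\,d(x,y)$ for all $x,y$. **Proposition.** There is a function $K=K(L,b)$ such that for every $L>0$: 1. every piecewise geodesic $\gamma:\mathbb R\to\mathbb H^3$ with $\|\gamma\|_L<G(L)$ is $K(L,\|\gamma\|_L)$-bilipschitz; 2. for every finite-leaved measured lamination $\mu$ on $\mathbb H^2$ with $\|\mu\|_L<G(L)$, the pleated plane $P_\mu$ is a $K(L,\|\mu\|_L)$-bilipschitz embedding. -/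

import Mathlib

open scoped ENNReal

noncomputable section

/-- The Lorentz form `-x₀y₀ + x₁y₁ + ⋯ + xₙyₙ` on `ℝⁿ⁺¹`. -/
def lor {n : ℕ} (x y : Fin (n + 1) → ℝ) : ℝ :=
  -(x 0 * y 0) + ∑ i : Fin n, x i.succ * y i.succ

/-- Hyperbolic `n`-space, in the hyperboloid model. -/
def Hyp (n : ℕ) : Type :=
  {x : Fin (n + 1) → ℝ // lor x x = -1 ∧ 0 < x 0}

instance (n : ℕ) : TopologicalSpace (Hyp n) :=
  inferInstanceAs (TopologicalSpace {x : Fin (n + 1) → ℝ // lor x x = -1 ∧ 0 < x 0})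

/-- The point of `ℝⁿ⁺¹` underlying a point of hyperbolic space. -/
def Hyp.vec {n : ℕ} (p : Hyp n) : Fin (n + 1) → ℝ := p.1

/-- The hyperbolic distance: `cosh d(p, q) = -⟨p, q⟩`. -/
def hdist {n : ℕ} (p q : Hyp n) : ℝ := Real.arcosh (-(lor p.vec q.vec))

/-- A complete unit-speed geodesic. -/
def IsGeodesicLine {n : ℕ} (α : ℝ → Hyp n) : Prop :=
  ∀ s t : ℝ, hdist (α s) (α t) = |s - t|

/-- A unit-speed piecewise geodesic `ℝ → ℍⁿ`: a continuous path which is a unit-speed geodesic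
arc on every interval free of points of `T`, for some closed discrete set `T ⊆ ℝ`
(that is, one with finitely many points in every bounded interval). -/
def IsPiecewiseGeodesic {n : ℕ} (γ : ℝ → Hyp n) : Prop :=
  Continuous γ ∧ ∃ T : Set ℝ, (∀ a b : ℝ, (T ∩ Set.Icc a b).Finite) ∧
    ∀ a b : ℝ, Disjoint (Set.Ioo a b) T →
      ∀ s ∈ Set.Ioo a b, ∀ t ∈ Set.Ioo a b, hdist (γ s) (γ t) = |s - t|

/-- The exterior angle of a path at time `t`: the angle between the one-sided velocities
`γ'₋(t)` and `γ'₊(t)`, unit vectors in the tangent space at `γ t`, on which the Lorentz form is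
the Riemannian metric. It is `0` wherever a piecewise geodesic does not bend. -/
def bendAngle {n : ℕ} (γ : ℝ → Hyp n) (t : ℝ) : ℝ :=
  Real.arccos (lor (derivWithin (fun s => (γ s).vec) (Set.Iic t) t)
    (derivWithin (fun s => (γ s).vec) (Set.Ici t) t))

/-- `‖γ‖_L`: the supremum of the total bending of `γ` over all open subsegments of length `L`. -/
def pathRoundness {n : ℕ} (L : ℝ) (γ : ℝ → Hyp n) : ℝ≥0∞ :=
  ⨆ a : ℝ, ∑' t : Set.Ioo a (a + L), ENNReal.ofReal (bendAngle γ t)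

/-- `l ⊆ ℍ²` is a complete geodesic with unit normal `w`, i.e. the section of the hyperboloid by the
plane orthogonal to the unit spacelike vector `w`. The two sides of `l` are given by the sign of `⟨·, w⟩`. -/
def IsUnitNormal (l : Set (Hyp 2)) (w : Fin 3 → ℝ) : Prop :=
  lor w w = 1 ∧ ∀ z : Hyp 2, z ∈ l ↔ lor z.vec w = 0

/-- A finite-leaved measured lamination on `ℍ²`: finitely many pairwise disjoint complete
geodesics, each with a positive mass. -/
structure FiniteLamination where
  leaves : Finset (Set (Hyp 2))
  mass : Set (Hyp 2) → ℝ
  geodesic : ∀ l ∈ leaves, ∃ w, IsUnitNormal l w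
  disjoint : ∀ l ∈ leaves, ∀ l' ∈ leaves, l ≠ l' → Disjoint l l'
  mass_pos : ∀ l ∈ leaves, 0 < mass l

open Classical in
/-- `i(μ, a)` for a geodesic arc `a`: the total mass of the leaves that meet `a`
transversely. -/
def FiniteLamination.inter (μ : FiniteLamination) (a : Set (Hyp 2)) : ℝ≥0∞ :=
  ∑ l ∈ μ.leaves, if (l ∩ a).Nonempty ∧ ¬ a ⊆ l then ENNReal.ofReal (μ.mass l) else 0

/-- `‖μ‖_L`: the supremum of `i(μ, a)` over all open geodesic arcs `a` of length `L`. -/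
def FiniteLamination.roundness (L : ℝ) (μ : FiniteLamination) : ℝ≥0∞ :=
  ⨆ (α : ℝ → Hyp 2) (_ : IsGeodesicLine α), μ.inter (α '' Set.Ioo 0 L)

/-- `z` and `z'` lie strictly on opposite sides of the geodesic `l`. -/
def Separates (l : Set (Hyp 2)) (z z' : Hyp 2) : Prop :=
  ∃ w, IsUnitNormal l w ∧ lor z.vec w < 0 ∧ 0 < lor z'.vec w

/-- The inclusion of `ℝ³` in `ℝ⁴` as the first three coordinates, carrying `ℍ²` to a totally
geodesic plane in `ℍ³` with unit normal vector `e₃`. -/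
def planeIncl (x : Fin 3 → ℝ) : Fin 4 → ℝ := ![x 0, x 1, x 2, 0]

/-- For `w` a unit normal of a geodesic `l` of `ℍ²`, this is the rotation of `ℝ⁴` by the angle `θ`
about (the span of) `l`: it fixes the orthogonal complement of `w` and `e₃`, and
`w ↦ cos θ w + sin θ e₃`, `e₃ ↦ -sin θ w + cos θ e₃`. -/
def bend (w : Fin 3 → ℝ) (θ : ℝ) (x : Fin 4 → ℝ) : Fin 4 → ℝ :=
  let a := lor x (planeIncl w)
  let b := x 3
  x + (a * Real.cos θ - b * Real.sin θ - a) • planeIncl w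
    + (a * Real.sin θ + b * Real.cos θ - b) • ![0, 0, 0, 1]

/-- `P` is a pleated plane with bending lamination `μ`, i.e. `P = P_μ` up to an isometry of `ℍ³`.
A flat is a complementary region of the leaves, i.e. a class of points off the leaves no two of
which are separated by a leaf. To each flat (that of `z`) belongs a Lorentz transformation `A z`;
on the closure of the flat, `P` is the isometric embedding `A z ∘ planeIncl`, with unit normal
`A z e₃`; and when a leaf `l` is crossed, the flat is turned about `P l` by the angle `μ l`
towards this normal, always to the same side. -/
def IsPleatedPlane (μ : FiniteLamination) (P : Hyp 2 → Hyp 3) : Prop :=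
  ∃ A : Hyp 2 → ((Fin 4 → ℝ) →ₗ[ℝ] (Fin 4 → ℝ)),
    (∀ z, ∀ x y, lor (A z x) (A z y) = lor x y) ∧
    (∀ z, (∀ l ∈ μ.leaves, z ∉ l) → ∀ z', (∀ l ∈ μ.leaves, ¬ Separates l z z') →
      (P z').vec = A z (planeIncl z'.vec) ∧ ((∀ l ∈ μ.leaves, z' ∉ l) → A z' = A z)) ∧
    (∀ z z', (∀ l ∈ μ.leaves, z ∉ l) → (∀ l ∈ μ.leaves, z' ∉ l) →
      ∀ l ∈ μ.leaves, (∀ l' ∈ μ.leaves, l' ≠ l → ¬ Separates l' z z') →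
        ∀ w, IsUnitNormal l w → lor z.vec w < 0 → 0 < lor z'.vec w →
          ∀ x, A z' x = A z (bend w (μ.mass l) x))

/-- A map between hyperbolic spaces (or from the line), with distances `d` on its source, is
`K`-bilipschitz. -/
def IsBilipschitz {X : Type*} {n : ℕ} (d : X → X → ℝ) (K : ℝ) (f : X → Hyp n) : Prop :=
  ∀ x y : X, K⁻¹ * d x y ≤ hdist (f x) (f y) ∧ hdist (f x) (f y) ≤ K * d x y

/-- The hill function `h(x) = arccos (tanh x)`. -/
def hill (x : ℝ) : ℝ := Real.arccos (Real.tanh x)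

/-- The points `x` at which the tangent line to the graph of the hill function meets the graph
again over `x - L`. -/
def tangentPoints (L : ℝ) : Set ℝ :=
  {x | deriv hill x = (hill x - hill (x - L)) / L}

/-- `c(L)`: the unique element of `tangentPoints L` when `L > 0`. -/
def hillC (L : ℝ) : ℝ := sInf (tangentPoints L)

/-- `G(L) = h(c(L) - L) - h(c(L))`. -/
def hillG (L : ℝ) : ℝ := hill (hillC L - L) - hill (hillC L)

theorem hasDerivAt_hill (x : ℝ) : HasDerivAt hill (-(Real.cosh x)⁻¹) x := by
  have hc : 0 < Real.cosh x := Real.cosh_pos x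
  have ht : HasDerivAt Real.tanh ((Real.cosh x ^ 2)⁻¹) x := by
    have h := (Real.hasDerivAt_sinh x).div (Real.hasDerivAt_cosh x) hc.ne'
    have e : (Real.sinh / Real.cosh) = Real.tanh := by
      funext y; simp [Real.tanh_eq_sinh_div_cosh]
    rw [e] at h
    refine h.congr_deriv ?_
    have h2 : Real.cosh x * Real.cosh x - Real.sinh x * Real.sinh x = 1 := by
      have := Real.cosh_sq x
      nlinarith
    rw [h2, one_div]
  have h1 : 1 - Real.tanh x ^ 2 = ((Real.cosh x)⁻¹) ^ 2 := by
    rw [Real.tanh_eq_sinh_div_cosh]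
    have := Real.cosh_sq x
    field_simp
    linarith
  have hp : 0 < ((Real.cosh x)⁻¹) ^ 2 := by positivity
  have hne1 : Real.tanh x ≠ -1 := by
    intro h; rw [← h1, h] at hp; norm_num at hp
  have hne2 : Real.tanh x ≠ 1 := by
    intro h; rw [← h1, h] at hp; norm_num at hp
  have h2 := (Real.hasDerivAt_arccos hne1 hne2).comp x ht
  have h3 : √(1 - Real.tanh x ^ 2) = (Real.cosh x)⁻¹ := by
    rw [h1]; exact Real.sqrt_sq (by positivity)
  rw [h3] at h2
  refine h2.congr_deriv ?_
  field_simp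

theorem hill_sub (x L : ℝ) (hL : 0 < L) :
    ∃ ξ ∈ Set.Ioo (x - L) x, hill x - hill (x - L) = -(L * (Real.cosh ξ)⁻¹) := by
  have hd : Differentiable ℝ hill := fun y => (hasDerivAt_hill y).differentiableAt
  obtain ⟨ξ, hξ, h⟩ := exists_deriv_eq_slope hill (by linarith : x - L < x)
    hd.continuous.continuousOn hd.differentiableOn
  refine ⟨ξ, hξ, ?_⟩
  rw [(hasDerivAt_hill ξ).deriv] at h
  have : x - (x - L) = L := by ring
  rw [this, eq_div_iff hL.ne'] at h
  linarith

/-- The tangency point `c(L)` exists and is unique, and lies in `(0, L)`. -/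
theorem tangentPoints_eq (L : ℝ) (hL : 0 < L) :
    tangentPoints L = {hillC L} ∧ hillC L ∈ Set.Ioo 0 L := by
  set f : ℝ → ℝ := fun x => hill x - hill (x - L) + L * (Real.cosh x)⁻¹ with hf
  have hmem : ∀ x, x ∈ tangentPoints L ↔ f x = 0 := by
    intro x
    simp only [tangentPoints, Set.mem_ofPred_eq, (hasDerivAt_hill x).deriv, hf]
    rw [eq_div_iff hL.ne']
    constructor <;> intro h <;> linarith
  have hfd : ∀ x, HasDerivAt f (-(Real.cosh x)⁻¹ + (Real.cosh (x - L))⁻¹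
      + L * (-Real.sinh x / Real.cosh x ^ 2)) x := by
    intro x
    have h1 := (hasDerivAt_hill (x - L)).comp x ((hasDerivAt_id x).sub_const L)
    have h2 := ((Real.hasDerivAt_cosh x).inv (Real.cosh_pos x).ne').const_mul L
    have h := ((hasDerivAt_hill x).sub h1).add h2
    refine h.congr_deriv ?_
    ring
  have hfc : Continuous f :=
    continuous_iff_continuousAt.2 fun x => (hfd x).continuousAt
  have hval : ∀ x, ∃ ξ ∈ Set.Ioo (x - L) x,
      f x = L * ((Real.cosh x)⁻¹ - (Real.cosh ξ)⁻¹) := by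
    intro x
    obtain ⟨ξ, h1, h2⟩ := hill_sub x L hL
    exact ⟨ξ, h1, by simp only [hf]; rw [h2]; ring⟩
  have hloc : ∀ x, f x = 0 → x ∈ Set.Ioo 0 (L / 2) := by
    intro x hx
    obtain ⟨ξ, ⟨h1, h2⟩, h3⟩ := hval x
    rw [hx] at h3
    have h4 : (Real.cosh x)⁻¹ = (Real.cosh ξ)⁻¹ := by
      have := (mul_eq_zero.1 h3.symm).resolve_left hL.ne'
      linarith
    have h5 : |x| = |ξ| := by
      have h6 := inv_injective h4
      exact le_antisymm (Real.cosh_le_cosh.1 h6.le) (Real.cosh_le_cosh.1 h6.ge)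
    rcases abs_eq_abs.1 h5 with h | h
    · exact absurd h h2.ne'
    · constructor <;> linarith
  have hanti : StrictAntiOn f (Set.Icc 0 (L / 2)) := by
    refine strictAntiOn_of_deriv_neg (convex_Icc _ _) hfc.continuousOn ?_
    intro x hx
    rw [interior_Icc] at hx
    obtain ⟨h1, h2⟩ := hx
    rw [(hfd x).deriv]
    have h3 : Real.cosh x < Real.cosh (x - L) := by
      rw [Real.cosh_lt_cosh, abs_of_pos h1, abs_of_neg (by linarith)]
      linarith
    have h4 : (Real.cosh (x - L))⁻¹ < (Real.cosh x)⁻¹ :=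
      inv_strictAnti₀ (Real.cosh_pos x) h3
    have h5 : 0 < L * (Real.sinh x / Real.cosh x ^ 2) :=
      mul_pos hL (div_pos (Real.sinh_pos_iff.2 h1) (pow_pos (Real.cosh_pos x) 2))
    have h6 : L * (-Real.sinh x / Real.cosh x ^ 2)
        = -(L * (Real.sinh x / Real.cosh x ^ 2)) := by ring
    rw [h6]
    linarith
  have h0 : 0 < f 0 := by
    obtain ⟨ξ, ⟨h1, h2⟩, h3⟩ := hval 0
    rw [h3]
    refine mul_pos hL (sub_pos.2 (inv_strictAnti₀ (Real.cosh_pos _) ?_))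
    rw [Real.cosh_lt_cosh, abs_zero]
    exact abs_pos.2 h2.ne
  have h1 : f (L / 2) < 0 := by
    obtain ⟨ξ, ⟨h1, h2⟩, h3⟩ := hval (L / 2)
    rw [h3]
    refine mul_neg_of_pos_of_neg hL (sub_neg.2 (inv_strictAnti₀ (Real.cosh_pos _) ?_))
    rw [Real.cosh_lt_cosh, abs_of_pos (by linarith : 0 < L / 2), abs_lt]
    constructor <;> linarith
  obtain ⟨c, hc, hfc0⟩ := intermediate_value_Icc' (by linarith : (0 : ℝ) ≤ L / 2)
    hfc.continuousOn ⟨h1.le, h0.le⟩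
  have hset : tangentPoints L = {c} := by
    ext x
    rw [hmem, Set.mem_singleton_iff]
    refine ⟨fun hx => ?_, fun hx => hx ▸ hfc0⟩
    exact hanti.injOn (Set.Ioo_subset_Icc_self (hloc x hx)) hc (hx.trans hfc0.symm)
  have hcc : hillC L = c := by rw [hillC, hset, csInf_singleton]
  rw [hcc]
  refine ⟨hset, (hloc c hfc0).1, ?_⟩
  have := (hloc c hfc0).2
  linarith

end

/-!
Both parts rest on one comparison. Fix a base point `p` and follow a path `γ`; let `r` be the
distance from `p` and `θ` the angle between the velocity and the direction pointing away from `p`.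
Write `θ = hill x`. Along a geodesic arc `x` increases at least as fast as the time, and at a bend
by an angle `β` the angle `θ` increases by at most `β`. So `x` stays above the *comparison process*
that moves right with unit speed and, at each bend, jumps left so that `hill` increases by `β`.

If the bending over length `L` is at most `b < G(L)`, the comparison process started at `c(L)` stays
right of `c(L) - L` and passes `c(L) + δ` before time `L - δ`, for some `δ > 0` depending on `L` and
`b` (`comparison_jump`, `comparison_returns`). The reason is that over `[c(L) - L, c(L)]` the graph
of `hill` lies above its tangent line at `c(L)`, and `G(L) = L sech c(L)` is the rise of this line.

Growth of `r` at large scale comes from the plane orthogonal to `γ` at signed distance `x` behind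
`γ t`. Along a geodesic arc this plane does not move, at a bend it moves to a plane tangent to it at
infinity, further from `p` (`bend_depth_le`), and each time the process is set back from `c(L) + δ`
to `c(L)` it moves away from `p` by another `δ` (`Dominated.reset`). Thus after `m` periods
`r ≥ m δ - L`. At small scale, `θ` is bounded away from `π`, and `sinh r (cos θ + M sin θ)` grows
with at least unit speed along arcs while a bend by `β` costs at most a factor `exp ((1 + M) β)`. The two
estimates together give `r ≥ k |s - t|` with `k = lowerConst L b`
(`IsPiecewiseGeodesic.hdist_bounds`). All of this involves only `A = cosh r` and its one-sided
derivatives; `RadialProfile` isolates the properties of these that are needed.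

A pleated plane maps a geodesic that starts off the leaves to a piecewise geodesic, which bends at
each leaf it crosses by at most the mass of the leaf (`bendAngle_pleated_le`). So the first part
applies to it (`pathRoundness_pleated_le`), and points on leaves are limits of points off the
leaves.
-/

/-! ### The Lorentz form -/

section Lorentz

variable {n : ℕ}

theorem lor_comm (x y : Fin (n + 1) → ℝ) : lor x y = lor y x := by
  simp only [lor, mul_comm]

theorem lor_add_left (x y z : Fin (n + 1) → ℝ) : lor (x + y) z = lor x z + lor y z := by
  simp only [lor, Pi.add_apply, add_mul, Finset.sum_add_distrib]
  ring

theorem lor_smul_left (a : ℝ) (x z : Fin (n + 1) → ℝ) : lor (a • x) z = a * lor x z := by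
  simp only [lor, Pi.smul_apply, smul_eq_mul, mul_assoc, mul_add, Finset.mul_sum]
  ring

theorem lor_add_right (x y z : Fin (n + 1) → ℝ) : lor x (y + z) = lor x y + lor x z := by
  rw [lor_comm, lor_add_left, lor_comm y, lor_comm z]

theorem lor_smul_right (a : ℝ) (x z : Fin (n + 1) → ℝ) : lor x (a • z) = a * lor x z := by
  rw [lor_comm, lor_smul_left, lor_comm z]

theorem lor_neg_left (x z : Fin (n + 1) → ℝ) : lor (-x) z = -lor x z := by
  rw [← neg_one_smul ℝ x, lor_smul_left]; ring

theorem lor_neg_right (x z : Fin (n + 1) → ℝ) : lor x (-z) = -lor x z := by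
  rw [lor_comm, lor_neg_left, lor_comm]

theorem lor_sub_left (x y z : Fin (n + 1) → ℝ) : lor (x - y) z = lor x z - lor y z := by
  rw [sub_eq_add_neg, lor_add_left, lor_neg_left]; ring

theorem lor_sub_right (x y z : Fin (n + 1) → ℝ) : lor x (y - z) = lor x y - lor x z := by
  rw [lor_comm, lor_sub_left, lor_comm y, lor_comm z]

theorem Hyp.lor_self (p : Hyp n) : lor p.vec p.vec = -1 := p.2.1

theorem Hyp.zero_pos (p : Hyp n) : 0 < p.vec 0 := p.2.2

theorem Hyp.ext_vec {p q : Hyp n} (h : p.vec = q.vec) : p = q := Subtype.ext h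

theorem Hyp.continuous_vec : Continuous (Hyp.vec : Hyp n → _) := continuous_subtype_val

/-- The Lorentz form is positive definite on the tangent spaces of hyperbolic space. -/
theorem lor_self_of_orth (q : Hyp n) {x : Fin (n + 1) → ℝ} (hx : lor q.vec x = 0) :
    0 ≤ lor x x ∧ (lor x x = 0 → x = 0) := by
  have hq := q.lor_self
  have h0 := q.zero_pos
  have cs := Finset.sum_mul_sq_le_sq_mul_sq Finset.univ
    (fun i : Fin n => q.vec i.succ) (fun i : Fin n => x i.succ)
  simp only [lor] at hx hq ⊢
  simp only [← pow_two] at hq ⊢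
  set Q := ∑ i : Fin n, q.vec i.succ ^ 2
  set X := ∑ i : Fin n, x i.succ ^ 2 with hX
  have hXn : 0 ≤ X := Finset.sum_nonneg fun i _ => sq_nonneg _
  have e : ∑ i : Fin n, q.vec i.succ * x i.succ = q.vec 0 * x 0 := by linarith
  rw [e, show Q = q.vec 0 ^ 2 - 1 by linarith] at cs
  have h1 : X ≤ q.vec 0 ^ 2 * (X - x 0 ^ 2) := by nlinarith
  have h2 : 0 ≤ X - x 0 ^ 2 := by
    by_contra hneg
    have : q.vec 0 ^ 2 * (X - x 0 ^ 2) < 0 := mul_neg_of_pos_of_neg (by positivity) (by linarith)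
    linarith
  refine ⟨by linarith, fun hz => ?_⟩
  have hX0 : X = 0 := by
    have : X - x 0 ^ 2 = 0 := by linarith
    rw [this, mul_zero] at h1
    linarith
  have hx0 : x 0 = 0 := by
    have : x 0 ^ 2 = 0 := by linarith
    exact pow_eq_zero_iff two_ne_zero |>.1 this
  have hxi := (Finset.sum_eq_zero_iff_of_nonneg fun i _ => sq_nonneg (x (Fin.succ i))).1 hX0
  funext i
  refine Fin.cases hx0 (fun j => ?_) i
  exact pow_eq_zero_iff two_ne_zero |>.1 (hxi j (Finset.mem_univ _))

/-- The Cauchy–Schwarz inequality in a tangent space of hyperbolic space. -/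
theorem lor_sq_le_of_orth (q : Hyp n) {x y : Fin (n + 1) → ℝ} (hx : lor q.vec x = 0)
    (hy : lor q.vec y = 0) : lor x y ^ 2 ≤ lor x x * lor y y := by
  have h : ∀ a : ℝ, 0 ≤ lor y y * (a * a) + 2 * lor x y * a + lor x x := by
    intro a
    have := (lor_self_of_orth q (x := x + a • y)
      (by rw [lor_add_right, lor_smul_right, hx, hy]; ring)).1
    rw [lor_add_right, lor_smul_right, lor_add_left, lor_add_left, lor_smul_left, lor_smul_left,
      lor_comm y x] at this
    linarith
  have := discrim_le_zero h
  unfold discrim at this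
  nlinarith

theorem abs_lor_le_one (q : Hyp n) {x y : Fin (n + 1) → ℝ} (hx : lor q.vec x = 0)
    (hy : lor q.vec y = 0) (hx1 : lor x x = 1) (hy1 : lor y y = 1) : |lor x y| ≤ 1 := by
  have := lor_sq_le_of_orth q hx hy
  rw [hx1, hy1] at this
  exact (sq_le_one_iff_abs_le_one _).1 (by linarith)

/-- The triangle inequality for angles between unit tangent vectors at a point. -/
theorem arccos_lor_triangle (q : Hyp n) {u v w : Fin (n + 1) → ℝ} (hu : lor q.vec u = 0)
    (hv : lor q.vec v = 0) (hw : lor q.vec w = 0) (hu1 : lor u u = 1) (hv1 : lor v v = 1)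
    (hw1 : lor w w = 1) :
    Real.arccos (lor u w) ≤ Real.arccos (lor u v) + Real.arccos (lor v w) := by
  have b1 := abs_le.1 (abs_lor_le_one q hu hv hu1 hv1)
  have b2 := abs_le.1 (abs_lor_le_one q hv hw hv1 hw1)
  set a := Real.arccos (lor u v) with ha
  set b := Real.arccos (lor v w) with hb
  have ca : Real.cos a = lor u v := Real.cos_arccos b1.1 b1.2
  have cb : Real.cos b = lor v w := Real.cos_arccos b2.1 b2.2
  have a0 : 0 ≤ a := Real.arccos_nonneg _
  have b0 : 0 ≤ b := Real.arccos_nonneg _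
  rcases le_or_gt (a + b) Real.pi with hab | hab
  · have key : Real.cos (a + b) ≤ lor u w := by
      have sa : 0 ≤ Real.sin a := Real.sin_nonneg_of_nonneg_of_le_pi a0 (Real.arccos_le_pi _)
      have sb : 0 ≤ Real.sin b := Real.sin_nonneg_of_nonneg_of_le_pi b0 (Real.arccos_le_pi _)
      have cs := lor_sq_le_of_orth q (x := u - lor u v • v) (y := w - lor v w • v)
        (by rw [lor_sub_right, lor_smul_right, hu, hv]; ring)
        (by rw [lor_sub_right, lor_smul_right, hw, hv]; ring)
      simp only [lor_sub_left, lor_sub_right, lor_smul_left, lor_smul_right, hu1, hv1, hw1,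
        lor_comm v u, lor_comm w v] at cs
      rw [← ca, ← cb] at cs
      have ea := Real.sin_sq_add_cos_sq a
      have eb := Real.sin_sq_add_cos_sq b
      have : (lor u w - Real.cos a * Real.cos b) ^ 2 ≤ (Real.sin a * Real.sin b) ^ 2 := by
        rw [mul_pow, show Real.sin a ^ 2 = 1 - Real.cos a ^ 2 by linarith,
          show Real.sin b ^ 2 = 1 - Real.cos b ^ 2 by linarith]
        nlinarith
      have := abs_le_of_sq_le_sq' this (mul_nonneg sa sb)
      rw [Real.cos_add]
      linarith [this.1]
    rw [← Real.arccos_cos (add_nonneg a0 b0) hab]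
    exact Real.arccos_le_arccos key
  · exact (Real.arccos_le_pi _).trans hab.le

/-- `p + ⟨p, q⟩ q` is the component of `p` tangent at `q`; its square is `⟨p, q⟩² - 1`. -/
theorem lor_self_add_smul (p q : Hyp n) :
    lor q.vec (p.vec + lor p.vec q.vec • q.vec) = 0 ∧
      lor (p.vec + lor p.vec q.vec • q.vec) (p.vec + lor p.vec q.vec • q.vec)
        = lor p.vec q.vec ^ 2 - 1 := by
  constructor
  · rw [lor_add_right, lor_smul_right, q.lor_self, lor_comm q.vec]; ring
  · simp only [lor_add_left, lor_add_right, lor_smul_left, lor_smul_right, q.lor_self, p.lor_self,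
      lor_comm q.vec p.vec]
    ring

theorem one_le_neg_lor (p q : Hyp n) : 1 ≤ -lor p.vec q.vec := by
  obtain ⟨h1, h2⟩ := lor_self_add_smul p q
  have h3 := (lor_self_of_orth q h1).1
  rw [h2] at h3
  have hneg : lor p.vec q.vec ≤ 0 := by
    have hp := p.lor_self
    have hq := q.lor_self
    have cs := Finset.sum_mul_sq_le_sq_mul_sq Finset.univ
      (fun i : Fin n => p.vec i.succ) (fun i : Fin n => q.vec i.succ)
    simp only [lor] at hp hq ⊢
    simp only [← pow_two] at hp hq
    have a : (∑ i : Fin n, p.vec i.succ * q.vec i.succ) ^ 2 ≤ (p.vec 0 * q.vec 0) ^ 2 := by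
      refine cs.trans ?_
      rw [mul_pow]
      exact mul_le_mul (by linarith) (by linarith)
        (Finset.sum_nonneg fun i _ => sq_nonneg _) (sq_nonneg _)
    have := (abs_le_of_sq_le_sq' a (mul_pos p.zero_pos q.zero_pos).le).2
    linarith
  nlinarith

theorem cosh_hdist (p q : Hyp n) : Real.cosh (hdist p q) = -lor p.vec q.vec :=
  Real.cosh_arcosh (one_le_neg_lor p q)

theorem hdist_nonneg (p q : Hyp n) : 0 ≤ hdist p q := Real.arcosh_nonneg (one_le_neg_lor p q)

theorem hdist_comm (p q : Hyp n) : hdist p q = hdist q p := by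
  rw [hdist, hdist, lor_comm]

theorem hdist_self (p : Hyp n) : hdist p p = 0 := by
  rw [hdist, p.lor_self, neg_neg, Real.arcosh_zero]

theorem hdist_triangle (p q r : Hyp n) : hdist p r ≤ hdist p q + hdist q r := by
  have h : Real.cosh (hdist p r) ≤ Real.cosh (hdist p q + hdist q r) := by
    obtain ⟨h1, h2⟩ := lor_self_add_smul p q
    obtain ⟨h3, h4⟩ := lor_self_add_smul r q
    have cs := lor_sq_le_of_orth q h1 h3
    rw [h2, h4] at cs
    have e : lor (p.vec + lor p.vec q.vec • q.vec) (r.vec + lor r.vec q.vec • q.vec)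
        = lor p.vec r.vec + lor p.vec q.vec * lor r.vec q.vec := by
      simp only [lor_add_left, lor_add_right, lor_smul_left, lor_smul_right, q.lor_self,
        lor_comm q.vec]
      ring
    have s1 := Real.cosh_sq (hdist p q)
    have s2 := Real.cosh_sq (hdist q r)
    have n1 := Real.sinh_nonneg_iff.2 (hdist_nonneg p q)
    have n2 := Real.sinh_nonneg_iff.2 (hdist_nonneg q r)
    rw [Real.cosh_add, cosh_hdist, cosh_hdist, cosh_hdist]
    rw [cosh_hdist] at s1 s2
    rw [e] at cs
    have hs : (lor p.vec r.vec + lor p.vec q.vec * lor r.vec q.vec) ^ 2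
        ≤ (Real.sinh (hdist p q) * Real.sinh (hdist q r)) ^ 2 := by
      rw [mul_pow]
      rw [lor_comm q.vec] at s2
      nlinarith
    have := (abs_le_of_sq_le_sq' hs (mul_nonneg n1 n2)).1
    rw [lor_comm q.vec]
    linarith
  rw [Real.cosh_le_cosh, abs_of_nonneg (hdist_nonneg p r),
    abs_of_nonneg (add_nonneg (hdist_nonneg p q) (hdist_nonneg q r))] at h
  exact h

end Lorentz

/-! ### The hill function -/

theorem hill_strictAnti : StrictAnti hill :=
  strictAnti_of_deriv_neg fun x => by
    rw [(hasDerivAt_hill x).deriv]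
    exact neg_neg_of_pos (inv_pos.2 (Real.cosh_pos x))

theorem cos_hill (x : ℝ) : Real.cos (hill x) = Real.tanh x :=
  Real.cos_arccos (Real.neg_one_lt_tanh x).le (Real.tanh_lt_one x).le

theorem hill_pos (x : ℝ) : 0 < hill x := Real.arccos_pos.2 (Real.tanh_lt_one x)

theorem hill_lt_pi (x : ℝ) : hill x < Real.pi := by
  refine lt_of_le_of_ne (Real.arccos_le_pi _) fun h => ?_
  have := cos_hill x
  rw [show hill x = Real.pi from h, Real.cos_pi] at this
  linarith [Real.neg_one_lt_tanh x]

theorem sin_hill (x : ℝ) : Real.sin (hill x) = (Real.cosh x)⁻¹ := by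
  have h0 : 0 < Real.sin (hill x) := Real.sin_pos_of_pos_of_lt_pi (hill_pos x) (hill_lt_pi x)
  have hc := Real.cosh_pos x
  have h1 := Real.sin_sq_add_cos_sq (hill x)
  rw [cos_hill, Real.tanh_eq_sinh_div_cosh] at h1
  have h2 := Real.cosh_sq x
  refine (pow_left_inj₀ h0.le (inv_pos.2 hc).le two_ne_zero).1 ?_
  field_simp at h1 ⊢
  linarith

theorem exists_hill_eq {y : ℝ} (h0 : 0 < y) (h1 : y < Real.pi) : ∃ x, hill x = y := by
  have hs : 0 < Real.sin y := Real.sin_pos_of_pos_of_lt_pi h0 h1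
  refine ⟨Real.arsinh (Real.cos y / Real.sin y), ?_⟩
  have h2 : Real.tanh (Real.arsinh (Real.cos y / Real.sin y)) = Real.cos y := by
    rw [Real.tanh_eq_sinh_div_cosh, Real.sinh_arsinh, Real.cosh_arsinh]
    have : 1 + (Real.cos y / Real.sin y) ^ 2 = ((Real.sin y)⁻¹) ^ 2 := by
      field_simp
      linarith [Real.sin_sq_add_cos_sq y]
    rw [this, Real.sqrt_sq (inv_pos.2 hs).le]
    field_simp
  rw [hill, h2, Real.arccos_cos h0.le h1.le]

theorem hill_sub_bounds {y x κ : ℝ} (hyx : y ≤ x)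
    (hκ : ∀ u ∈ Set.Ioo y x, κ ≤ (Real.cosh u)⁻¹) :
    κ * (x - y) ≤ hill y - hill x ∧ hill y - hill x ≤ x - y := by
  rcases hyx.eq_or_lt with rfl | hlt
  · simp
  · obtain ⟨ξ, hξ, h⟩ := hill_sub x (x - y) (sub_pos.2 hlt)
    rw [sub_sub_cancel] at hξ h
    have h1 := hκ ξ hξ
    have h2 : (Real.cosh ξ)⁻¹ ≤ 1 := inv_le_one_of_one_le₀ (Real.one_le_cosh ξ)
    have h3 := sub_pos.2 hlt
    constructor <;> nlinarith

theorem inv_cosh_le_inv_cosh {x y : ℝ} (h : |x| ≤ |y|) : (Real.cosh y)⁻¹ ≤ (Real.cosh x)⁻¹ :=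
  inv_anti₀ (Real.cosh_pos x) (Real.cosh_le_cosh.2 h)

theorem inv_cosh_sub_le (x : ℝ) {δ : ℝ} (hδ : 0 ≤ δ) :
    (Real.cosh x)⁻¹ - δ ≤ (Real.cosh (x + δ))⁻¹ := by
  have hd : ∀ y, HasDerivAt (fun y => (Real.cosh y)⁻¹ + y)
      (-Real.sinh y / Real.cosh y ^ 2 + 1) y := fun y =>
    ((Real.hasDerivAt_cosh y).inv (Real.cosh_pos y).ne').add (hasDerivAt_id y)
  have hm : Monotone fun y => (Real.cosh y)⁻¹ + y := by
    refine monotone_of_deriv_nonneg (fun y => (hd y).differentiableAt) fun y => ?_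
    rw [(hd y).deriv]
    have h1 := Real.cosh_pos y
    have h2 : Real.sinh y ≤ Real.cosh y ^ 2 := by
      have := (Real.sinh_lt_cosh y).le
      nlinarith [Real.one_le_cosh y]
    have h3 : Real.sinh y / Real.cosh y ^ 2 ≤ 1 := (div_le_one (by positivity)).2 h2
    rw [neg_div]
    linarith
  have := hm (by linarith : x ≤ x + δ)
  simp only at this
  linarith

/-- Left of `σ / 2` the hill function is at least as steep at `y` as at `y - σ`. -/
theorem hill_shift_sub_le {x' x σ : ℝ} (hσ : 0 ≤ σ) (hx : x' ≤ x) (hxσ : x ≤ σ / 2) :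
    hill (x' - σ) - hill (x - σ) ≤ hill x' - hill x := by
  have hd : ∀ y, HasDerivAt (fun y => hill (y - σ) - hill y)
      (-(Real.cosh (y - σ))⁻¹ - -(Real.cosh y)⁻¹) y := fun y => by
    have := ((hasDerivAt_hill (y - σ)).comp y ((hasDerivAt_id y).sub_const σ)).sub
      (hasDerivAt_hill y)
    rw [mul_one] at this
    exact this
  have hm : MonotoneOn (fun y => hill (y - σ) - hill y) (Set.Iic (σ / 2)) := by
    refine monotoneOn_of_deriv_nonneg (convex_Iic _)
      (fun y _ => (hd y).continuousAt.continuousWithinAt)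
      (fun y _ => (hd y).differentiableAt.differentiableWithinAt) fun y hy => ?_
    rw [interior_Iic, Set.mem_Iio] at hy
    rw [(hd y).deriv]
    have : (Real.cosh (y - σ))⁻¹ ≤ (Real.cosh y)⁻¹ := by
      apply inv_cosh_le_inv_cosh
      rw [abs_of_nonpos (by linarith : y - σ ≤ 0), abs_le]
      constructor <;> linarith
    linarith
  have := hm (Set.mem_Iic.2 (hx.trans hxσ)) (Set.mem_Iic.2 hxσ) hx
  simp only at this
  linarith

theorem hill_hillC_sub {L : ℝ} (hL : 0 < L) :
    hill (hillC L - L) = hill (hillC L) + L * (Real.cosh (hillC L))⁻¹ := by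
  have h : hillC L ∈ tangentPoints L := by rw [(tangentPoints_eq L hL).1]; rfl
  rw [tangentPoints, Set.mem_ofPred_eq, (hasDerivAt_hill _).deriv, eq_div_iff hL.ne'] at h
  linarith

theorem hillG_eq {L : ℝ} (hL : 0 < L) : hillG L = L * (Real.cosh (hillC L))⁻¹ := by
  rw [hillG, hill_hillC_sub hL]; ring

theorem hillC_pos {L : ℝ} (hL : 0 < L) : 0 < hillC L := (tangentPoints_eq L hL).2.1

/-- Over `[c(L) - L, c(L)]` the graph of the hill function lies above its tangent line at `c(L)`. -/
theorem tangent_le_hill {L σ : ℝ} (hL : 0 < L) (h0 : 0 ≤ σ) (h1 : σ ≤ L) :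
    hill (hillC L) + σ * (Real.cosh (hillC L))⁻¹ ≤ hill (hillC L - σ) := by
  set c := hillC L with hc
  have hcp : 0 < c := hillC_pos hL
  rcases le_or_gt σ (2 * c) with h | h
  · have := (hill_sub_bounds (κ := (Real.cosh c)⁻¹) (by linarith : c - σ ≤ c) fun u hu => by
      apply inv_cosh_le_inv_cosh
      rw [abs_of_pos hcp, abs_le]
      constructor <;> linarith [hu.1, hu.2]).1
    rw [sub_sub_cancel] at this
    linarith
  · rcases h1.eq_or_lt with rfl | hlt
    · rw [hill_hillC_sub hL]
    obtain ⟨ξ, hξ, e⟩ := hill_sub (c - σ) (L - σ) (sub_pos.2 hlt)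
    rw [show c - σ - (L - σ) = c - L by ring, hill_hillC_sub hL, ← hc] at e
    rw [show c - σ - (L - σ) = c - L by ring] at hξ
    have : (Real.cosh ξ)⁻¹ ≤ (Real.cosh c)⁻¹ := by
      apply inv_cosh_le_inv_cosh
      rw [abs_of_pos hcp, abs_of_neg (by linarith [hξ.2])]
      linarith [hξ.2]
    nlinarith

/-! ### The comparison process -/

/-- Effect of a bend by the angle `β` on the budget of the comparison process, `E` being the bending
spent so far and `τ` the elapsed time. The estimate `hE` counts a descent of the hill function at
rate `κ` for a part `τ - σ` of the elapsed time, and keeps the rest `σ` as a shift of the state. A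
jump that starts left of `σ / 2` costs no more at the shifted state, so the shift is kept; otherwise
`[x - σ, x] ⊆ [-c, c]`, where the hill function descends at rate at least `κ`, and the shift is
converted into descent. -/
theorem comparison_jump {c κ h E τ σ x x' β : ℝ} (hκ : κ = (Real.cosh c)⁻¹)
    (hx : x ≤ c) (hσ : 0 ≤ σ) (hστ : σ ≤ τ)
    (hE : hill (x - σ) ≤ h + E - (τ - σ) * κ) (hβ : 0 ≤ β) (hx' : hill x' = hill x + β) :
    ∃ σ', 0 ≤ σ' ∧ σ' ≤ τ ∧ hill (x' - σ') ≤ h + (E + β) - (τ - σ') * κ := by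
  have hxx : x' ≤ x := hill_strictAnti.le_iff_ge.1 (by linarith)
  rcases le_or_gt x (σ / 2) with h1 | h1
  · exact ⟨σ, hσ, hστ, by linarith [hill_shift_sub_le hσ hxx h1]⟩
  · refine ⟨0, le_rfl, hσ.trans hστ, ?_⟩
    have := (hill_sub_bounds (κ := κ) (by linarith : x - σ ≤ x) fun u hu => by
      rw [hκ]
      apply inv_cosh_le_inv_cosh
      rw [abs_of_pos (by linarith : 0 < c), abs_le]
      constructor <;> linarith [hu.1, hu.2]).1
    rw [sub_sub_cancel] at this
    rw [sub_zero, hx']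
    linarith

/-- With bending less than `G(L)`, the comparison process started at `c(L)` passes `c(L) + δ`
before time `L - δ`. -/
theorem comparison_returns {L b δ σ x : ℝ} (hL : 0 < L) (hδ0 : 0 < δ)
    (hδ : δ * (L + 4) = hillG L - b) (hσ : 0 ≤ σ) (hσL : σ ≤ L - δ)
    (hE : hill (x - σ) ≤ hill (hillC L) + b
      - (L - δ - σ) * (Real.cosh (hillC L + δ))⁻¹) : hillC L + δ < x := by
  by_contra hx
  push Not at hx
  set c := hillC L with hc
  have h1 := tangent_le_hill hL hσ (by linarith : σ ≤ L)
  rw [← hc] at h1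
  have h2 : hill (c + δ - σ) ≤ hill (x - σ) := hill_strictAnti.antitone (by linarith)
  have h3 := (hill_sub_bounds (κ := 0) (by linarith : c - σ ≤ c + δ - σ) fun u _ =>
    (inv_pos.2 (Real.cosh_pos u)).le).2
  have h4 := inv_cosh_sub_le c hδ0.le
  have h5 : (Real.cosh c)⁻¹ ≤ 1 := inv_le_one_of_one_le₀ (Real.one_le_cosh c)
  have h6 := hillG_eq hL
  rw [← hc] at h6
  have h7 : (L - δ - σ) * ((Real.cosh c)⁻¹ - δ) ≤ (L - δ - σ) * (Real.cosh (c + δ))⁻¹ :=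
    mul_le_mul_of_nonneg_left h4 (by linarith)
  have h8 : δ * (Real.cosh c)⁻¹ ≤ δ := by nlinarith
  nlinarith [mul_nonneg hδ0.le hσ, sq_nonneg δ]

/-! ### Radial data along a bent path -/

theorem tanh_strictMono : StrictMono Real.tanh := fun x y h => by
  rw [← cos_hill, ← cos_hill]
  exact Real.cos_lt_cos_of_nonneg_of_le_pi (hill_pos y).le (hill_lt_pi x).le (hill_strictAnti h)

/-- The effect of a bend at distance `r` from the base point on the plane orthogonal to the path:
here `A = cosh r` and `S = sinh r`. -/
theorem bend_depth_le {x x' A S θ θ' β : ℝ} (h0 : 0 ≤ S) (hSA : S ≤ A)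
    (hθ' : θ' ∈ Set.Icc 0 Real.pi) (hβ : |θ' - θ| ≤ β)
    (hx' : hill x' = hill x + β) (hθx : θ ≤ hill x) :
    Real.sinh x' * A - Real.cosh x' * (S * Real.cos θ')
      ≤ Real.sinh x * A - Real.cosh x * (S * Real.cos θ) := by
  have hβ0 : 0 ≤ β := (abs_nonneg _).trans hβ
  have hab := abs_le.1 hβ
  have hπ := hill_lt_pi x'
  set η := hill x with hη
  have hη0 : 0 < η := hill_pos x
  have hηπ : η < Real.pi := hill_lt_pi x
  have sη : 0 < Real.sin η := Real.sin_pos_of_pos_of_lt_pi hη0 hηπ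
  have sη' : 0 < Real.sin (η + β) := hx' ▸ Real.sin_pos_of_pos_of_lt_pi (hill_pos x') hπ
  have c1 : Real.cosh x = (Real.sin η)⁻¹ := by rw [hη, sin_hill, inv_inv]
  have c2 : Real.cosh x' = (Real.sin (η + β))⁻¹ := by rw [← hx', sin_hill, inv_inv]
  have s1 : Real.sinh x = Real.cos η / Real.sin η := by
    rw [hη, cos_hill, sin_hill, Real.tanh_eq_sinh_div_cosh]
    field_simp [(Real.cosh_pos x).ne']
  have s2 : Real.sinh x' = Real.cos (η + β) / Real.sin (η + β) := by
    rw [← hx', cos_hill, sin_hill, Real.tanh_eq_sinh_div_cosh]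
    field_simp [(Real.cosh_pos x').ne']
  have hcos : Real.cos (θ + β) ≤ Real.cos θ' :=
    Real.cos_le_cos_of_nonneg_of_le_pi hθ'.1 (by linarith) (by linarith)
  rw [c1, c2, s1, s2]
  have e1 : Real.cos (η + β) / Real.sin (η + β) * A - (Real.sin (η + β))⁻¹ * (S * Real.cos θ')
      = (Real.cos (η + β) * A - S * Real.cos θ') / Real.sin (η + β) := by field_simp
  have e2 : Real.cos η / Real.sin η * A - (Real.sin η)⁻¹ * (S * Real.cos θ)
      = (Real.cos η * A - S * Real.cos θ) / Real.sin η := by field_simp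
  rw [e1, e2, div_le_div_iff₀ sη' sη]
  have sβ : 0 ≤ Real.sin β := Real.sin_nonneg_of_nonneg_of_le_pi hβ0 (by linarith)
  have key : Real.sin β * (S * Real.cos (η - θ)) ≤ Real.sin β * A := by
    refine mul_le_mul_of_nonneg_left ?_ sβ
    nlinarith [Real.cos_le_one (η - θ)]
  have hmono : S * Real.cos (θ + β) * Real.sin η ≤ S * Real.cos θ' * Real.sin η :=
    mul_le_mul_of_nonneg_right (mul_le_mul_of_nonneg_left hcos h0) sη.le
  have id1 : Real.cos (η + β) * A * Real.sin η - Real.cos η * A * Real.sin (η + β)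
      = -(Real.sin β * A) := by
    rw [Real.cos_add, Real.sin_add]
    linear_combination (-(Real.sin β * A)) * Real.sin_sq_add_cos_sq η
  have id2 : S * Real.cos θ * Real.sin (η + β) - S * Real.cos (θ + β) * Real.sin η
      = Real.sin β * (S * Real.cos (η - θ)) := by
    rw [Real.cos_add, Real.sin_add, Real.cos_sub]
    ring
  linarith

theorem one_le_cos_add_sin {θ Θ M : ℝ} (hθ : θ ∈ Set.Icc 0 Real.pi) (hθΘ : θ ≤ Θ)
    (hΘπ : Θ < Real.pi) (hM2 : 2 ≤ M) (hM : M * Real.sin Θ = 2) :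
    1 ≤ Real.cos θ + M * Real.sin θ := by
  have hs : 0 ≤ Real.sin θ := Real.sin_nonneg_of_nonneg_of_le_pi hθ.1 hθ.2
  rcases le_or_gt θ (Real.pi / 2) with h1 | h1
  · have hc : 0 ≤ Real.cos θ := Real.cos_nonneg_of_neg_pi_div_two_le_of_le
      (by linarith [hθ.1, Real.pi_pos]) h1
    have h2 : Real.cos θ ^ 2 ≤ Real.cos θ := by nlinarith [Real.cos_le_one θ]
    have h3 : Real.sin θ ^ 2 ≤ Real.sin θ := by nlinarith [Real.sin_le_one θ]
    have h4 : 2 * Real.sin θ ≤ M * Real.sin θ := mul_le_mul_of_nonneg_right hM2 hs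
    linarith [Real.sin_sq_add_cos_sq θ]
  · have h2 : Real.sin Θ ≤ Real.sin θ := by
      rw [← Real.cos_sub_pi_div_two, ← Real.cos_sub_pi_div_two θ]
      exact Real.cos_le_cos_of_nonneg_of_le_pi (by linarith)
        (by linarith [Real.pi_pos]) (by linarith)
    have h3 : M * Real.sin Θ ≤ M * Real.sin θ := mul_le_mul_of_nonneg_left h2 (by linarith)
    linarith [Real.neg_one_le_cos θ]

/-- For a path `γ`, a time `t` and a base point `p` at distance `r` put `A = cosh r` and
`B = (cosh r)' = sinh r cos θ`, where `θ` is the angle at `γ t` between the velocity and the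
direction pointing away from `p`. The state `x` of the comparison process dominates these data when
the following four estimates hold; `y` is a signed distance, `s` the starting time, `M` a constant
and `w` the accumulated weight of the bends. -/
structure Dominated (M s y w t x A B : ℝ) : Prop where
  /-- `θ ≤ hill x` -/
  angle : √(A ^ 2 - 1) * Real.tanh x ≤ B
  /-- The plane orthogonal to `γ` at signed distance `x` behind `γ t` has `p` at signed distance at
  most `y`. -/
  depth : Real.sinh x * A - Real.cosh x * B ≤ Real.sinh y
  /-- `sinh r (cos θ + M sin θ)` grows with unit speed, up to the loss in bends. -/
  growth : t - s ≤ (B + M * √(A ^ 2 - 1 - B ^ 2)) * Real.exp w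
  dist : A ≤ Real.cosh (t - s)

theorem Dominated.flow {M s y w t x A B τ : ℝ} (h : Dominated M s y w t x A B) (hA : 1 ≤ A)
    (hB : B ^ 2 ≤ A ^ 2 - 1) (hw : 0 ≤ w) (hst : s ≤ t) (hτ : 0 ≤ τ) :
    Dominated M s y w (t + τ) (x + τ) (A * Real.cosh τ + B * Real.sinh τ)
      (A * Real.sinh τ + B * Real.cosh τ) := by
  have hct := Real.cosh_sq τ
  have hst0 : 0 ≤ Real.sinh τ := Real.sinh_nonneg_iff.2 hτ
  have hcτ := Real.cosh_pos τ
  have hinv : (A * Real.cosh τ + B * Real.sinh τ) ^ 2 - 1 - (A * Real.sinh τ + B * Real.cosh τ) ^ 2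
      = A ^ 2 - 1 - B ^ 2 := by
    linear_combination (A ^ 2 - B ^ 2) * hct
  -- Along the segment `A = k cosh (u + ·)` and `B = k sinh (u + ·)` with `1 ≤ k`.
  obtain ⟨k, u, hk, hAk, hBk⟩ : ∃ k u : ℝ, 1 ≤ k ∧ A = k * Real.cosh u ∧ B = k * Real.sinh u := by
    have hk2 : 0 < A ^ 2 - B ^ 2 := by linarith
    have hk := Real.sqrt_pos.2 hk2
    have hks := Real.sq_sqrt hk2.le
    have hB' : B = √(A ^ 2 - B ^ 2) * Real.sinh (Real.arsinh (B / √(A ^ 2 - B ^ 2))) := by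
      rw [Real.sinh_arsinh]; field_simp
    refine ⟨√(A ^ 2 - B ^ 2), Real.arsinh (B / √(A ^ 2 - B ^ 2)), ?_, ?_, hB'⟩
    · rw [Real.one_le_sqrt]; linarith
    · have h1 := Real.cosh_sq (Real.arsinh (B / √(A ^ 2 - B ^ 2)))
      have h2 := Real.cosh_pos (Real.arsinh (B / √(A ^ 2 - B ^ 2)))
      refine (pow_left_inj₀ (by linarith) (by positivity) two_ne_zero).1 ?_
      rw [mul_pow, h1, mul_add, ← mul_pow, ← hB', hks]; ring
  have hBinc : B + τ ≤ A * Real.sinh τ + B * Real.cosh τ := by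
    have h1 : A * Real.sinh τ + B * Real.cosh τ = k * Real.sinh (u + τ) := by
      rw [Real.sinh_add, hAk, hBk]; ring
    have h2 := Real.sinh_sub_id_strictMono.monotone (by linarith : u ≤ u + τ)
    rw [h1, hBk]
    nlinarith
  refine ⟨?_, ?_, ?_, ?_⟩
  · rw [show (A * Real.cosh τ + B * Real.sinh τ) ^ 2 - 1
      = (A * Real.sinh τ + B * Real.cosh τ) ^ 2 + (A ^ 2 - 1 - B ^ 2) by linarith]
    set κ := √(A ^ 2 - 1 - B ^ 2) with hκ
    have hκ2 : κ ^ 2 = A ^ 2 - 1 - B ^ 2 := Real.sq_sqrt (by linarith)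
    have hang := h.angle
    rcases (Real.sqrt_nonneg (A ^ 2 - 1 - B ^ 2)).eq_or_lt with h0 | h0
    · -- The line through the segment passes through `p`.
      rw [← hκ] at h0
      have hz : A ^ 2 - 1 - B ^ 2 = 0 := by rw [← hκ2, ← h0]; ring
      have hS : √(A ^ 2 - 1) = |B| := by
        rw [show A ^ 2 - 1 = B ^ 2 by linarith, Real.sqrt_sq_eq_abs]
      have hB0 : 0 ≤ B := by
        by_contra hneg
        push Not at hneg
        rw [hS, abs_of_neg hneg] at hang
        nlinarith [Real.neg_one_lt_tanh x]
      have hB1 : 0 ≤ A * Real.sinh τ + B * Real.cosh τ := by positivity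
      rw [hz, add_zero, Real.sqrt_sq hB1]
      nlinarith [Real.tanh_lt_one (x + τ)]
    · rw [← hκ] at h0
      -- `z` is the state at which the angle equals `hill z`.
      set z := Real.arsinh (B / κ) with hz
      have hs : κ * Real.sinh z = B := by rw [hz, Real.sinh_arsinh]; field_simp
      have hc : κ * Real.cosh z = √(A ^ 2 - 1) := by
        refine (pow_left_inj₀ (by positivity) (Real.sqrt_nonneg _) two_ne_zero).1 ?_
        rw [mul_pow, Real.cosh_sq, Real.sq_sqrt (show 0 ≤ A ^ 2 - 1 by nlinarith), mul_add,
          ← mul_pow, hs, hκ2]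
        ring
      have hS0 : 0 < √(A ^ 2 - 1) := hc ▸ mul_pos h0 (Real.cosh_pos z)
      have hxz : Real.sinh x ≤ Real.sinh z := by
        rw [Real.sinh_le_sinh]
        by_contra hlt
        push Not at hlt
        have := tanh_strictMono hlt
        rw [Real.tanh_eq_sinh_div_cosh z] at this
        have h3 : Real.sinh z / Real.cosh z = B / √(A ^ 2 - 1) := by
          rw [← hs, ← hc]; field_simp
        rw [h3, div_lt_iff₀ hS0] at this
        linarith
      rw [Real.sinh_le_sinh] at hxz
      have h1 : κ * Real.sinh (z + τ) ≤ A * Real.sinh τ + B * Real.cosh τ := by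
        rw [Real.sinh_add, mul_add, ← mul_assoc, ← mul_assoc, hs, hc]
        have : √(A ^ 2 - 1) ≤ A := by
          rw [Real.sqrt_le_left (by linarith)]; linarith
        nlinarith
      have h2 : κ * Real.sinh (x + τ) ≤ A * Real.sinh τ + B * Real.cosh τ :=
        (mul_le_mul_of_nonneg_left (Real.sinh_le_sinh.2 (by linarith)) h0.le).trans h1
      set B' := A * Real.sinh τ + B * Real.cosh τ
      set z' := Real.arsinh (B' / κ) with hz'
      have hs' : κ * Real.sinh z' = B' := by rw [hz', Real.sinh_arsinh]; field_simp
      have hc' : κ * Real.cosh z' = √(B' ^ 2 + (A ^ 2 - 1 - B ^ 2)) := by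
        refine (pow_left_inj₀ (mul_pos h0 (Real.cosh_pos _)).le (Real.sqrt_nonneg _)
          two_ne_zero).1 ?_
        rw [mul_pow, Real.cosh_sq,
          Real.sq_sqrt (show 0 ≤ B' ^ 2 + (A ^ 2 - 1 - B ^ 2) by nlinarith), mul_add, ← mul_pow,
          hs', hκ2]
        ring
      rw [← hc', ← hs', mul_assoc]
      refine mul_le_mul_of_nonneg_left ?_ h0.le
      have h3 : x + τ ≤ z' := by
        rw [← Real.sinh_le_sinh]
        rw [← hs'] at h2
        exact le_of_mul_le_mul_left h2 h0
      have h4 := tanh_strictMono.monotone h3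
      calc Real.cosh z' * Real.tanh (x + τ) ≤ Real.cosh z' * Real.tanh z' :=
            mul_le_mul_of_nonneg_left h4 (Real.cosh_pos z').le
        _ = Real.sinh z' := by
            rw [Real.tanh_eq_sinh_div_cosh]; field_simp [(Real.cosh_pos z').ne']
  · have : Real.sinh (x + τ) * (A * Real.cosh τ + B * Real.sinh τ)
        - Real.cosh (x + τ) * (A * Real.sinh τ + B * Real.cosh τ)
        = Real.sinh x * A - Real.cosh x * B := by
      rw [Real.sinh_add, Real.cosh_add]
      linear_combination (Real.sinh x * A - Real.cosh x * B) * hct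
    rw [this]
    exact h.depth
  · rw [hinv]
    have h1 := h.growth
    have h2 := Real.one_le_exp hw
    nlinarith
  · have h1 := h.dist
    have hρ : 0 ≤ t - s := by linarith
    have h2 : B ≤ Real.sinh (t - s) := by
      refine (abs_le_of_sq_le_sq' ?_ (Real.sinh_nonneg_iff.2 hρ)).2
      have := Real.cosh_sq (t - s)
      nlinarith
    rw [show t + τ - s = (t - s) + τ by ring, Real.cosh_add]
    nlinarith

theorem Dominated.bend {M s y w t x x' A B B' θ θ' β Θ : ℝ} (h : Dominated M s y w t x A B)
    (hA : 1 ≤ A) (hθ : θ ∈ Set.Icc 0 Real.pi) (hθ' : θ' ∈ Set.Icc 0 Real.pi)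
    (hB : B = √(A ^ 2 - 1) * Real.cos θ) (hB' : B' = √(A ^ 2 - 1) * Real.cos θ')
    (hβ : |θ' - θ| ≤ β) (hx' : hill x' = hill x + β) (hΘ : hill x' ≤ Θ) (hΘπ : Θ < Real.pi)
    (hM : M = 2 / Real.sin Θ) : Dominated M s y (w + (1 + M) * β) t x' A B' := by
  have hβ0 : 0 ≤ β := (abs_nonneg _).trans hβ
  have hxx : x' ≤ x := hill_strictAnti.le_iff_ge.1 (by linarith)
  have hΘ0 : 0 < Θ := (hill_pos x').trans_le hΘ
  have hsΘ : 0 < Real.sin Θ := Real.sin_pos_of_pos_of_lt_pi hΘ0 hΘπ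
  have hM2 : 2 ≤ M := by
    rw [hM, le_div_iff₀ hsΘ]; linarith [Real.sin_le_one Θ]
  obtain ⟨hangle, hdepth, hgrowth, hdist⟩ := h
  rcases (Real.sqrt_nonneg (A ^ 2 - 1)).eq_or_lt with h0 | h0
  · -- The bend is at the base point.
    rw [← h0, zero_mul] at hB hB'
    subst hB hB'
    have hA1 : A = 1 := by
      have := Real.sqrt_eq_zero'.1 h0.symm
      nlinarith
    subst hA1
    refine ⟨by simp, ?_, ?_, hdist⟩
    · have := Real.sinh_le_sinh.2 hxx
      linarith
    · simp at hgrowth ⊢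
      exact hgrowth
  set S := √(A ^ 2 - 1) with hS
  have hS2 : S ^ 2 = A ^ 2 - 1 := Real.sq_sqrt (by nlinarith)
  have hSA : S ≤ A := by rw [hS, Real.sqrt_le_left (by linarith)]; linarith
  have hθx : θ ≤ hill x := by
    rw [hB] at hangle
    have := le_of_mul_le_mul_left hangle h0
    rw [← cos_hill] at this
    by_contra hlt
    push Not at hlt
    exact absurd (Real.cos_lt_cos_of_nonneg_of_le_pi (hill_pos x).le hθ.2 hlt) (not_lt.2 this)
  have hab := abs_le.1 hβ
  have hπ := hill_lt_pi x'
  have hθx' : θ' ≤ hill x' := by linarith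
  refine ⟨?_, ?_, ?_, hdist⟩
  · rw [hB', ← cos_hill]
    refine mul_le_mul_of_nonneg_left ?_ h0.le
    exact Real.cos_le_cos_of_nonneg_of_le_pi hθ'.1 hπ.le hθx'
  · refine le_trans ?_ hdepth
    rw [hB, hB']
    exact bend_depth_le h0.le hSA hθ' hβ hx' hθx
  · have hV : ∀ ψ ∈ Set.Icc 0 Real.pi, S * Real.cos ψ + M * √(A ^ 2 - 1 - (S * Real.cos ψ) ^ 2)
        = S * (Real.cos ψ + M * Real.sin ψ) := by
      intro ψ hψ
      have : A ^ 2 - 1 - (S * Real.cos ψ) ^ 2 = (S * Real.sin ψ) ^ 2 := by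
        rw [← hS2]
        linear_combination (-(S ^ 2)) * Real.sin_sq_add_cos_sq ψ
      rw [this, Real.sqrt_sq (mul_nonneg h0.le (Real.sin_nonneg_of_nonneg_of_le_pi hψ.1 hψ.2))]
      ring
    rw [hB, hV θ hθ] at hgrowth
    rw [hB', hV θ' hθ']
    have hφ' := one_le_cos_add_sin hθ' (hθx'.trans hΘ) hΘπ hM2 (by rw [hM]; field_simp)
    have hφ : Real.cos θ + M * Real.sin θ
        ≤ Real.cos θ' + M * Real.sin θ' + (1 + M) * β := by
      have h1 := abs_le.1 ((Real.abs_cos_sub_cos_le θ' θ).trans hβ)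
      have h2 := abs_le.1 ((Real.abs_sin_sub_sin_le θ' θ).trans hβ)
      have h3 := mul_le_mul_of_nonneg_left h2.1 (by linarith : 0 ≤ M)
      linarith
    have hexp : Real.cos θ + M * Real.sin θ
        ≤ (Real.cos θ' + M * Real.sin θ') * Real.exp ((1 + M) * β) := by
      have h1 := Real.add_one_le_exp ((1 + M) * β)
      have h2 : 0 ≤ (1 + M) * β := by positivity
      nlinarith
    rw [Real.exp_add]
    have hw0 := Real.exp_pos w
    calc t - s ≤ S * (Real.cos θ + M * Real.sin θ) * Real.exp w := hgrowth
      _ ≤ S * ((Real.cos θ' + M * Real.sin θ') * Real.exp ((1 + M) * β)) * Real.exp w := by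
          gcongr
      _ = _ := by ring

/-- Passing from `x = c + δ` back to `x = c` moves the plane by `δ` away from the base point. -/
theorem Dominated.reset {M s y w t c δ A B : ℝ} (h : Dominated M s y w t (c + δ) A B)
    (hB : B ^ 2 ≤ A ^ 2 - 1) (hA : 1 ≤ A) (hδ : 0 ≤ δ) : Dominated M s (y - δ) w t c A B := by
  refine ⟨?_, ?_, h.growth, h.dist⟩
  · exact (mul_le_mul_of_nonneg_left (tanh_strictMono.monotone (by linarith))
      (Real.sqrt_nonneg _)).trans h.angle
  · have hd := h.depth
    set X := c + δ
    set q := Real.arsinh (Real.sinh X * A - Real.cosh X * B) with hq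
    have hs : Real.sinh q = Real.sinh X * A - Real.cosh X * B := Real.sinh_arsinh _
    have hqy : q ≤ y := by rw [← Real.sinh_le_sinh, hs]; exact hd
    have hZ : Real.cosh q ≤ Real.cosh X * A - Real.sinh X * B := by
      have hX := Real.cosh_sq X
      have hpos : 0 ≤ Real.cosh X * A - Real.sinh X * B := by
        have h1 : |Real.sinh X| ≤ Real.cosh X := by
          rw [Real.abs_sinh, ← Real.cosh_abs X]; exact (Real.sinh_lt_cosh _).le
        have h2 : |B| ≤ A := abs_le_of_sq_le_sq (by linarith) (by linarith)
        have h3 : Real.sinh X * B ≤ Real.cosh X * A := by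
          calc Real.sinh X * B ≤ |Real.sinh X| * |B| := by
                rw [← abs_mul]; exact le_abs_self _
            _ ≤ _ := by gcongr
        linarith
      refine (abs_le_of_sq_le_sq' ?_ hpos).2
      rw [Real.cosh_sq, hs]
      have : (Real.cosh X * A - Real.sinh X * B) ^ 2 - (Real.sinh X * A - Real.cosh X * B) ^ 2
          = A ^ 2 - B ^ 2 := by linear_combination (A ^ 2 - B ^ 2) * hX
      linarith
    have e : Real.sinh c * A - Real.cosh c * B
        = Real.cosh δ * Real.sinh q - Real.sinh δ * (Real.cosh X * A - Real.sinh X * B) := by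
      have hc : c = X - δ := by simp [X]
      rw [hc, hs, Real.sinh_sub, Real.cosh_sub]; ring
    calc Real.sinh c * A - Real.cosh c * B
        ≤ Real.cosh δ * Real.sinh q - Real.sinh δ * Real.cosh q := by
          rw [e]
          have := mul_le_mul_of_nonneg_left hZ (Real.sinh_nonneg_iff.2 hδ)
          linarith
      _ = Real.sinh (q - δ) := by rw [Real.sinh_sub]; ring
      _ ≤ Real.sinh (y - δ) := Real.sinh_le_sinh.2 (by linarith)

/-! ### Linear growth of the distance -/

/-- The radial data along a path, as seen from a base point: `A` is the hyperbolic cosine of the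
distance, `BL` and `BR` are its one-sided derivatives. Off `T` the path is geodesic, and `β` is its
bending angle. -/
structure RadialProfile (T : Set ℝ) (β A BL BR : ℝ → ℝ) : Prop where
  finite : ∀ a b : ℝ, (T ∩ Set.Icc a b).Finite
  segment : ∀ t u : ℝ, t < u → Disjoint (Set.Ioo t u) T →
    A u = A t * Real.cosh (u - t) + BR t * Real.sinh (u - t) ∧
    BL u = A t * Real.sinh (u - t) + BR t * Real.cosh (u - t)
  bend : ∀ t, ∃ θ ∈ Set.Icc 0 Real.pi, ∃ θ' ∈ Set.Icc 0 Real.pi,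
    BL t = √(A t ^ 2 - 1) * Real.cos θ ∧ BR t = √(A t ^ 2 - 1) * Real.cos θ' ∧ |θ' - θ| ≤ β t
  one_le : ∀ t, 1 ≤ A t

theorem Dominated.mono_weight {M s y w w' t x A B : ℝ} (h : Dominated M s y w t x A B)
    (hw : w ≤ w') (hst : s ≤ t) : Dominated M s y w' t x A B := by
  refine ⟨h.angle, h.depth, ?_, h.dist⟩
  have hg := h.growth
  have h0 : 0 ≤ B + M * √(A ^ 2 - 1 - B ^ 2) := by
    by_contra hneg
    push Not at hneg
    have := mul_neg_of_neg_of_pos hneg (Real.exp_pos w)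
    linarith
  exact hg.trans (mul_le_mul_of_nonneg_left (Real.exp_le_exp.2 hw) h0)

theorem sq_mul_cos_le {A θ : ℝ} (hA : 1 ≤ A) : (√(A ^ 2 - 1) * Real.cos θ) ^ 2 ≤ A ^ 2 - 1 := by
  rw [mul_pow, Real.sq_sqrt (by nlinarith)]
  exact mul_le_of_le_one_right (by nlinarith) (Real.cos_sq_le_one θ)

namespace RadialProfile

variable {T : Set ℝ} {β A BL BR : ℝ → ℝ}

theorem angle_nonneg (h : RadialProfile T β A BL BR) (t : ℝ) : 0 ≤ β t := by
  obtain ⟨θ, -, θ', -, -, -, h1⟩ := h.bend t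
  exact (abs_nonneg _).trans h1

theorem sq_left_le (h : RadialProfile T β A BL BR) (t : ℝ) : BL t ^ 2 ≤ A t ^ 2 - 1 := by
  obtain ⟨θ, -, θ', -, h1, -, -⟩ := h.bend t
  exact h1 ▸ sq_mul_cos_le (h.one_le t)

theorem sq_right_le (h : RadialProfile T β A BL BR) (t : ℝ) : BR t ^ 2 ≤ A t ^ 2 - 1 := by
  obtain ⟨θ, -, θ', -, -, h1, -⟩ := h.bend t
  exact h1 ▸ sq_mul_cos_le (h.one_le t)

/-- The first point of `T` after `t`, or `e` if there is none before `e`. -/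
theorem exists_next (h : RadialProfile T β A BL BR) {t e : ℝ} (hte : t < e) :
    ∃ u, t < u ∧ u ≤ e ∧ Disjoint (Set.Ioo t u) T ∧ (u = e ∨ u ∈ T ∩ Set.Ioo t e) := by
  have hfin : (T ∩ Set.Ioo t e).Finite :=
    (h.finite t e).subset (Set.inter_subset_inter_right _ Set.Ioo_subset_Icc_self)
  rcases (T ∩ Set.Ioo t e).eq_empty_or_nonempty with h0 | h0
  · refine ⟨e, hte, le_rfl, ?_, Or.inl rfl⟩
    rwa [disjoint_comm, Set.disjoint_iff_inter_eq_empty]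
  · obtain ⟨u, hu, hmin⟩ := hfin.exists_minimal h0
    refine ⟨u, hu.2.1, hu.2.2.le, ?_, Or.inr hu⟩
    rw [Set.disjoint_left]
    intro v hv hvT
    have := hmin ⟨hvT, hv.1, hv.2.trans hu.2.2⟩ hv.2.le
    exact absurd hv.2 (not_lt.2 this)

/-- One period of the comparison: if the path bends by at most `b < G(L)` over `[a, a + L - δ)` and
its radial data at `a` are dominated by the state `c(L)`, then they are so again at a later time of
this interval, with the orthogonal plane at least `δ` further from the base point. -/
theorem exists_return (h : RadialProfile T β A BL BR) {L b δ s a y W M : ℝ} (hL : 0 < L)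
    (hb : 0 ≤ b) (hδ0 : 0 < δ) (hδ : δ * (L + 4) = hillG L - b) (hδL : δ < L)
    (hM : M = 2 / Real.sin (hill (hillC L) + b)) (hsa : s ≤ a) (hW : 0 ≤ W)
    (hwin : ∀ F : Finset ℝ, (∀ u ∈ F, a ≤ u ∧ u < a + (L - δ)) → ∑ u ∈ F, β u ≤ b)
    (ha : Dominated M s y W a (hillC L) (A a) (BL a)) :
    ∃ a', a + δ ≤ a' ∧ a' ≤ a + (L - δ) ∧
      Dominated M s (y - δ) (W + (1 + M) * b) a' (hillC L) (A a') (BL a') ∧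
      ∀ u ∈ Set.Icc a a', ∃ x, hillC L - L < x ∧
        Dominated M s y (W + (1 + M) * b) u x (A u) (BL u) := by
  set c := hillC L with hc
  set e := a + (L - δ) with he
  have hΘ : hill c + b < hill (c - L) := by
    have : hillG L = hill (c - L) - hill c := rfl
    have : 0 < δ * (L + 4) := by positivity
    linarith
  have hΘπ : hill c + b < Real.pi := hΘ.trans (hill_lt_pi _)
  have hM0 : 0 < M := by
    rw [hM]
    exact div_pos two_pos (Real.sin_pos_of_pos_of_lt_pi (by linarith [hill_pos c]) hΘπ)
  have hhill : ∀ x, hill x ≤ hill c + b → c - L < x := fun x hx =>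
    hill_strictAnti.lt_iff_gt.1 (hx.trans_lt hΘ)
  -- Induction on the number of bends still to come before `e`. The state is `x`, taken before the
  -- bend at `t`, and `F` is the set of bends passed since `a`.
  have main : ∀ k : ℕ, ∀ t x σ : ℝ, ∀ F : Finset ℝ, (T ∩ Set.Ioo t e).ncard ≤ k → a ≤ t → t < e →
      x < c + δ → x ≤ c + (t - a) → (∀ u ∈ F, a ≤ u ∧ u < t) → 0 ≤ σ → σ ≤ t - a →
      hill (x - σ) ≤ hill c + ∑ u ∈ F, β u - (t - a - σ) * (Real.cosh (c + δ))⁻¹ →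
      Dominated M s y (W + (1 + M) * ∑ u ∈ F, β u) t x (A t) (BL t) →
      ∃ a', a + δ ≤ a' ∧ t < a' ∧ a' ≤ e ∧
        Dominated M s (y - δ) (W + (1 + M) * b) a' c (A a') (BL a') ∧
        ∀ u ∈ Set.Icc t a', ∃ x, c - L < x ∧
          Dominated M s y (W + (1 + M) * b) u x (A u) (BL u) := by
    intro k
    induction k with
    | zero => ?_
    | succ k ih => ?_
    all_goals
      intro t x σ F hk hat hte hxδ hxt hF hσ hσt hE hdom
      have hst : s ≤ t := hsa.trans hat
      have hcosh : 0 < (Real.cosh (c + δ))⁻¹ := inv_pos.2 (Real.cosh_pos _)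
      have hslack : 0 ≤ (t - a - σ) * (Real.cosh (c + δ))⁻¹ :=
        mul_nonneg (by linarith) hcosh.le
      have hxσ : hill x ≤ hill (x - σ) := hill_strictAnti.antitone (by linarith)
      have hβt := h.angle_nonneg t
      have htF : t ∉ F := fun hmem => (hF t hmem).2.ne rfl
      have hF' : ∀ u ∈ insert t F, a ≤ u ∧ u < e := by
        intro u hu
        rcases Finset.mem_insert.1 hu with rfl | hu
        · exact ⟨hat, hte⟩
        · exact ⟨(hF u hu).1, (hF u hu).2.trans hte⟩
      have hE' : ∑ u ∈ F, β u + β t ≤ b := by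
        have := hwin _ hF'
        rw [Finset.sum_insert htF] at this
        linarith
      set E := ∑ u ∈ F, β u with hEdef
      have hE0 : 0 ≤ E := Finset.sum_nonneg fun u _ => h.angle_nonneg u
      obtain ⟨x', hx'⟩ := exists_hill_eq (y := hill x + β t) (by linarith [hill_pos x])
        (by linarith)
      have hx'Θ : hill x' ≤ hill c + b := by linarith
      have hx'x : x' ≤ x := hill_strictAnti.le_iff_ge.1 (by linarith)
      obtain ⟨σ', hσ'0, hσ't, hE2⟩ := comparison_jump rfl hxδ.le hσ hσt hE hβt hx'
      obtain ⟨θ, hθ, θ', hθ', e1, e2, hθθ⟩ := h.bend t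
      have hdom2 := hdom.bend (h.one_le t) hθ hθ' e1 e2 hθθ hx' hx'Θ hΘπ hM
      rw [show W + (1 + M) * E + (1 + M) * β t = W + (1 + M) * (E + β t) by ring] at hdom2
      have hw0 : 0 ≤ W + (1 + M) * (E + β t) := by positivity
      have hwb : W + (1 + M) * (E + β t) ≤ W + (1 + M) * b := by gcongr
      obtain ⟨t₁, htt₁, ht₁e, hdisj, ht₁⟩ := h.exists_next hte
      have hflow : ∀ u, t < u → u ≤ t₁ →
          Dominated M s y (W + (1 + M) * (E + β t)) u (x' + (u - t)) (A u) (BL u) := by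
        intro u htu hut
        have hd := hdom2.flow (h.one_le t) (h.sq_right_le t) hw0 hst (sub_nonneg.2 htu.le)
        obtain ⟨g1, g2⟩ := h.segment t u htu
          (hdisj.mono_left (Set.Ioo_subset_Ioo_right hut))
        rwa [← g1, ← g2, add_sub_cancel] at hd
      have hbase : ∀ u, t ≤ u → u ≤ t₁ → ∃ x, c - L < x ∧
          Dominated M s y (W + (1 + M) * b) u x (A u) (BL u) := by
        intro u htu hut
        rcases htu.eq_or_lt with rfl | htu
        · refine ⟨x, hhill x (by linarith), hdom.mono_weight ?_ hst⟩
          have : E ≤ b := by linarith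
          gcongr
        · refine ⟨x' + (u - t), ?_, (hflow u htu hut).mono_weight hwb (by linarith)⟩
          have := hhill x' hx'Θ
          linarith
      rcases le_or_gt (c + δ) (x' + (t₁ - t)) with hret | hret
      · have hta' : t < t + (c + δ - x') := by linarith
        have hd := hflow (t + (c + δ - x')) hta' (by linarith)
        rw [show x' + (t + (c + δ - x') - t) = c + δ by ring] at hd
        exact ⟨t + (c + δ - x'), by linarith, hta', by linarith,
          (hd.mono_weight hwb (by linarith)).reset (h.sq_left_le _) (h.one_le _) hδ0.le,
          fun u hu => hbase u hu.1 (by linarith [hu.2])⟩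
      have hE3 : hill (x' + (t₁ - t) - (σ' + (t₁ - t))) ≤ hill c + (E + β t)
          - (t₁ - a - (σ' + (t₁ - t))) * (Real.cosh (c + δ))⁻¹ := by
        rw [add_sub_add_right_eq_sub, show t₁ - a - (σ' + (t₁ - t)) = t - a - σ' by ring]
        exact hE2
      -- The process cannot stay left of `c + δ` until `e`.
      have hne : t₁ ≠ e := by
        intro h1
        have := comparison_returns (σ := σ' + (t₁ - t)) (x := x' + (t₁ - t)) hL hδ0 hδ
          (by linarith) (by linarith) (by
            refine hE3.trans ?_
            rw [show t₁ - a = L - δ by linarith]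
            linarith)
        linarith
      have ht₁T : t₁ ∈ T ∩ Set.Ioo t e := ht₁.resolve_left hne
      have hfin : (T ∩ Set.Ioo t e).Finite :=
        (h.finite t e).subset (Set.inter_subset_inter_right _ Set.Ioo_subset_Icc_self)
      have hlt : (T ∩ Set.Ioo t₁ e).ncard < (T ∩ Set.Ioo t e).ncard := by
        refine Set.ncard_lt_ncard
          ⟨fun u hu => ⟨hu.1, htt₁.trans hu.2.1, hu.2.2⟩, fun hsub => ?_⟩ hfin
        exact lt_irrefl _ (hsub ht₁T).2.1
    · omega
    · obtain ⟨a', h1, h2, h3, h4, h5⟩ := ih t₁ (x' + (t₁ - t)) (σ' + (t₁ - t)) (insert t F)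
        (by omega) (by linarith) (lt_of_le_of_ne ht₁e hne) hret (by linarith)
        (by
          intro u hu
          rcases Finset.mem_insert.1 hu with rfl | hu
          · exact ⟨hat, htt₁⟩
          · exact ⟨(hF u hu).1, (hF u hu).2.trans htt₁⟩)
        (by linarith) (by linarith)
        (by rw [Finset.sum_insert htF, add_comm (β t)]; exact hE3)
        (by rw [Finset.sum_insert htF, add_comm (β t)]; exact hflow t₁ htt₁ le_rfl)
      refine ⟨a', h1, htt₁.trans h2, h3, h4, fun u hu => ?_⟩
      rcases le_or_gt u t₁ with hut | hut
      · exact hbase u hu.1 hut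
      · exact h5 u ⟨hut.le, hu.2⟩
  obtain ⟨a', h1, -, h3, h4, h5⟩ := main _ a c 0 ∅ le_rfl le_rfl (by linarith) (by linarith)
    (by linarith) (by simp) le_rfl (by linarith) (by simp) (by simpa using ha)
  exact ⟨a', h1, h3, h4, h5⟩

/-- Iterating `exists_return` from the base point: at every later time the radial data are dominated
after some number `m` of periods. -/
theorem exists_dominated (h : RadialProfile T β A BL BR) {L b δ s M : ℝ} (hL : 0 < L)
    (hb : 0 ≤ b) (hδ0 : 0 < δ) (hδ : δ * (L + 4) = hillG L - b) (hδL : δ < L)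
    (hM : M = 2 / Real.sin (hill (hillC L) + b)) (hM0 : 0 ≤ M)
    (hwin : ∀ a, ∀ F : Finset ℝ, (∀ u ∈ F, a ≤ u ∧ u < a + (L - δ)) → ∑ u ∈ F, β u ≤ b)
    (hs : A s = 1) {u : ℝ} (hu : s ≤ u) :
    ∃ m : ℕ, ∃ x, u ≤ s + (m + 1) * L ∧ hillC L - L < x ∧
      Dominated M s (hillC L - m * δ) ((m + 1) * ((1 + M) * b)) u x (A u) (BL u) := by
  have chain : ∀ n : ℕ, ∃ a, s + n * δ ≤ a ∧ a ≤ s + n * L ∧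
      Dominated M s (hillC L - n * δ) (n * ((1 + M) * b)) a (hillC L) (A a) (BL a) ∧
      ∀ u ∈ Set.Icc s a, ∃ m : ℕ, ∃ x, u ≤ s + (m + 1) * L ∧ hillC L - L < x ∧
        Dominated M s (hillC L - m * δ) ((m + 1) * ((1 + M) * b)) u x (A u) (BL u) := by
    intro n
    induction n with
    | zero =>
      have hBL : BL s = 0 := by
        have := h.sq_left_le s
        rw [hs] at this
        nlinarith [sq_nonneg (BL s)]
      have h0 : Dominated M s (hillC L) 0 s (hillC L) (A s) (BL s) := by
        rw [hs, hBL]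
        exact ⟨by simp, by simp, by simp, by simp⟩
      refine ⟨s, by simp, by simp, by simpa using h0, fun u hu => ?_⟩
      obtain rfl : u = s := le_antisymm hu.2 hu.1
      refine ⟨0, hillC L, by simp [hL.le], by linarith, ?_⟩
      have := h0.mono_weight (w' := (1 + M) * b) (by positivity) le_rfl
      simpa using this
    | succ n ih =>
      obtain ⟨a, h1, h2, h3, h4⟩ := ih
      have hsa : s ≤ a := le_trans (by linarith [mul_nonneg n.cast_nonneg hδ0.le]) h1
      obtain ⟨a', g1, g2, g3, g4⟩ := h.exists_return hL hb hδ0 hδ hδL hM hsa (by positivity)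
        (hwin a) h3
      have e1 : (n : ℝ) * ((1 + M) * b) + (1 + M) * b = (n + 1) * ((1 + M) * b) := by ring
      rw [e1] at g3
      simp only [e1] at g4
      refine ⟨a', by push_cast; linarith, by push_cast; linarith, ?_, fun u hu => ?_⟩
      · push_cast
        rwa [show hillC L - (n + 1) * δ = hillC L - n * δ - δ by ring]
      · rcases le_or_gt u a with hua | hua
        · exact h4 u ⟨hu.1, hua⟩
        · obtain ⟨x, hx, hd⟩ := g4 u ⟨hua.le, hu.2⟩
          exact ⟨n, x, by linarith [hu.2], hx, hd⟩
  obtain ⟨n, hn⟩ := exists_nat_gt ((u - s) / δ)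
  rw [div_lt_iff₀ hδ0] at hn
  obtain ⟨a, h1, -, -, h4⟩ := chain n
  exact h4 u ⟨hu, by linarith⟩

end RadialProfile

theorem sinh_le_two_mul {r : ℝ} (h0 : 0 ≤ r) (h1 : r ≤ 1) : Real.sinh r ≤ 2 * r := by
  have h2 := (abs_le.1 (Real.abs_exp_sub_one_sub_id_le (x := r) (by rwa [abs_of_nonneg h0]))).2
  have h3 := Real.add_one_le_exp (-r)
  rw [Real.sinh_eq]
  nlinarith

/-- A lower bilipschitz constant for paths bending by at most `b < G(L)` over length `L`. -/
noncomputable def lowerConst (L b : ℝ) : ℝ :=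
  let δ := (hillG L - b) / (L + 4)
  let C := 1 + 2 / Real.sin (hill (hillC L) + b)
  let n : ℝ := ⌈2 * L / δ⌉₊ + 1
  min (δ / (4 * L)) (min (1 / (n * L)) (Real.exp (-(n * (C * b))) / (2 * C)))

theorem sin_hill_hillC_add_pos {L b : ℝ} (hb : 0 ≤ b) (hbG : b < hillG L) :
    0 < Real.sin (hill (hillC L) + b) := by
  have h1 : hillG L = hill (hillC L - L) - hill (hillC L) := rfl
  exact Real.sin_pos_of_pos_of_lt_pi (by linarith [hill_pos (hillC L)])
    (by linarith [hill_lt_pi (hillC L - L)])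

theorem lowerConst_pos {L b : ℝ} (hL : 0 < L) (hb : 0 ≤ b) (hbG : b < hillG L) :
    0 < lowerConst L b := by
  have hδ : 0 < (hillG L - b) / (L + 4) := div_pos (by linarith) (by linarith)
  have hs := sin_hill_hillC_add_pos hb hbG
  simp only [lowerConst]
  refine lt_min (by positivity) (lt_min (by positivity) (by positivity))

theorem RadialProfile.dist_bounds {T : Set ℝ} {β A BL BR : ℝ → ℝ}
    (h : RadialProfile T β A BL BR) {L b s u r : ℝ} (hL : 0 < L) (hb : 0 ≤ b) (hbG : b < hillG L)
    (hwin : ∀ a, ∀ F : Finset ℝ, (∀ u ∈ F, a < u ∧ u < a + L) → ∑ u ∈ F, β u ≤ b)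
    (hs : A s = 1) (hu : s ≤ u) (hr : 0 ≤ r) (hrA : Real.cosh r = A u) :
    lowerConst L b * (u - s) ≤ r ∧ r ≤ u - s := by
  set δ := (hillG L - b) / (L + 4) with hδdef
  set M := 2 / Real.sin (hill (hillC L) + b) with hM
  have hM0 : 0 < M := div_pos two_pos (sin_hill_hillC_add_pos hb hbG)
  have hδ0 : 0 < δ := div_pos (by linarith) (by linarith)
  have hδ : δ * (L + 4) = hillG L - b := by rw [hδdef]; field_simp
  have hδL : δ < L := by
    have h1 := hillG_eq hL
    have h2 : (Real.cosh (hillC L))⁻¹ ≤ 1 := inv_le_one_of_one_le₀ (Real.one_le_cosh _)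
    nlinarith
  obtain ⟨m, x, hum, hx, hd⟩ := h.exists_dominated hL hb hδ0 hδ hδL hM hM0.le (fun a F hF =>
    hwin (a - δ) F fun v hv => ⟨by linarith [(hF v hv).1], by linarith [(hF v hv).2]⟩) hs hu
  have hS : √(A u ^ 2 - 1) = Real.sinh r := by
    rw [← hrA, Real.cosh_sq, add_sub_cancel_right, Real.sqrt_sq (Real.sinh_nonneg_iff.2 hr)]
  have hB : BL u ≤ Real.sinh r := by
    rw [← hS]
    exact Real.le_sqrt_of_sq_le (h.sq_left_le u)
  refine ⟨?_, ?_⟩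
  · have hdepth : m * δ - L ≤ r := by
      have h1 : Real.sinh (x - r) ≤ Real.sinh (hillC L - m * δ) := by
        refine le_trans ?_ hd.depth
        rw [← hrA, Real.sinh_sub]
        have := mul_le_mul_of_nonneg_left hB (Real.cosh_pos x).le
        linarith
      rw [Real.sinh_le_sinh] at h1
      linarith
    have hgrowth : u - s ≤ (1 + M) * Real.sinh r * Real.exp ((m + 1) * ((1 + M) * b)) := by
      refine hd.growth.trans (mul_le_mul_of_nonneg_right ?_ (Real.exp_pos _).le)
      have h1 : √(A u ^ 2 - 1 - BL u ^ 2) ≤ Real.sinh r := by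
        rw [← hS]
        exact Real.sqrt_le_sqrt (by linarith [sq_nonneg (BL u)])
      nlinarith
    have hus : 0 ≤ u - s := by linarith
    -- After many periods the growth by `δ` per period wins; before, the time is bounded and the
    -- growth estimate applies, unless already `1 ≤ r`.
    have hconst : lowerConst L b = min (δ / (4 * L)) (min (1 / ((⌈2 * L / δ⌉₊ + 1 : ℝ) * L))
      (Real.exp (-((⌈2 * L / δ⌉₊ + 1 : ℝ) * ((1 + M) * b))) / (2 * (1 + M)))) := rfl
    rw [hconst]
    have hn := Nat.le_ceil (2 * L / δ)
    rw [div_le_iff₀ hδ0] at hn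
    set n := ⌈2 * L / δ⌉₊ with hndef
    rcases lt_or_ge n m with hnm | hnm
    · have h1 : (n : ℝ) + 1 ≤ m := by exact_mod_cast hnm
      have hn0 : (0 : ℝ) ≤ n := n.cast_nonneg
      have h2 : 2 * L ≤ m * δ := by nlinarith
      have h3 : u - s ≤ 2 * m * L := by nlinarith
      calc _ ≤ δ / (4 * L) * (u - s) := mul_le_mul_of_nonneg_right (min_le_left _ _) hus
        _ ≤ δ / (4 * L) * (2 * m * L) := mul_le_mul_of_nonneg_left h3 (by positivity)
        _ = m * δ / 2 := by field_simp; ring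
        _ ≤ r := by linarith
    · have h1 : (m : ℝ) + 1 ≤ n + 1 := by exact_mod_cast Nat.succ_le_succ hnm
      rcases le_or_gt 1 r with hr1 | hr1
      · have h2 : u - s ≤ (n + 1) * L := by nlinarith
        calc _ ≤ 1 / ((n + 1 : ℝ) * L) * (u - s) :=
              mul_le_mul_of_nonneg_right ((min_le_right _ _).trans (min_le_left _ _)) hus
          _ ≤ 1 / ((n + 1 : ℝ) * L) * ((n + 1) * L) :=
              mul_le_mul_of_nonneg_left h2 (by positivity)
          _ = 1 := by field_simp
          _ ≤ r := hr1
      · have h2 : u - s ≤ (1 + M) * (2 * r) * Real.exp ((n + 1) * ((1 + M) * b)) := by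
          refine hgrowth.trans ?_
          have := sinh_le_two_mul hr hr1.le
          have h0 : 0 ≤ Real.sinh r := Real.sinh_nonneg_iff.2 hr
          gcongr
        calc _ ≤ Real.exp (-((n + 1 : ℝ) * ((1 + M) * b))) / (2 * (1 + M)) * (u - s) :=
              mul_le_mul_of_nonneg_right ((min_le_right _ _).trans (min_le_right _ _)) hus
          _ ≤ Real.exp (-((n + 1 : ℝ) * ((1 + M) * b))) / (2 * (1 + M))
              * ((1 + M) * (2 * r) * Real.exp ((n + 1) * ((1 + M) * b))) :=
              mul_le_mul_of_nonneg_left h2 (by positivity)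
          _ = r := by rw [Real.exp_neg]; field_simp
  · have h1 := hd.dist
    rw [← hrA, Real.cosh_le_cosh, abs_of_nonneg hr, abs_of_nonneg (by linarith)] at h1
    exact h1

/-! ### Piecewise geodesics -/

theorem hasDerivAt_cosh_smul_add_sinh_smul {n : ℕ} (p v : Fin n → ℝ) (t u : ℝ) :
    HasDerivAt (fun u => Real.cosh (u - t) • p + Real.sinh (u - t) • v)
      (Real.sinh (u - t) • p + Real.cosh (u - t) • v) u := by
  have h1 := ((Real.hasDerivAt_cosh (u - t)).comp u ((hasDerivAt_id u).sub_const t)).smul_const p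
  have h2 := ((Real.hasDerivAt_sinh (u - t)).comp u ((hasDerivAt_id u).sub_const t)).smul_const v
  rw [mul_one] at h1 h2
  exact h1.add h2

theorem derivWithin_of_eqOn {n : ℕ} {f : ℝ → Fin n → ℝ} {p v : Fin n → ℝ} {t t' : ℝ} (c : ℝ)
    (htt : t < t')
    (hf : ∀ u ∈ Set.Icc t t', f u = Real.cosh (u - c) • p + Real.sinh (u - c) • v) :
    derivWithin f (Set.Ici t) t = Real.sinh (t - c) • p + Real.cosh (t - c) • v ∧
      derivWithin f (Set.Iic t') t' = Real.sinh (t' - c) • p + Real.cosh (t' - c) • v := by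
  constructor
  · refine HasDerivWithinAt.derivWithin ?_ (uniqueDiffWithinAt_Ici t)
    refine (hasDerivAt_cosh_smul_add_sinh_smul p v c t).hasDerivWithinAt.congr_of_eventuallyEq ?_
      (hf t ⟨le_rfl, htt.le⟩)
    filter_upwards [Icc_mem_nhdsGE htt] with u hu using hf u hu
  · refine HasDerivWithinAt.derivWithin ?_ (uniqueDiffWithinAt_Iic t')
    refine (hasDerivAt_cosh_smul_add_sinh_smul p v c t').hasDerivWithinAt.congr_of_eventuallyEq ?_
      (hf t' ⟨htt.le, le_rfl⟩)
    filter_upwards [Icc_mem_nhdsLE htt] with u hu using hf u hu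

/-- A unit-speed geodesic arc in the hyperboloid model. -/
theorem exists_geodesic_formula {n : ℕ} {γ : ℝ → Hyp n} {t t' : ℝ} (htt : t < t')
    (hγ : ∀ s ∈ Set.Icc t t', ∀ u ∈ Set.Icc t t', -lor (γ s).vec (γ u).vec = Real.cosh (s - u)) :
    ∃ v, lor (γ t).vec v = 0 ∧ lor v v = 1 ∧ ∀ u ∈ Set.Icc t t',
      (γ u).vec = Real.cosh (u - t) • (γ t).vec + Real.sinh (u - t) • v := by
  have hd : 0 < Real.sinh (t' - t) := Real.sinh_pos_iff.2 (sub_pos.2 htt)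
  have hl : t ∈ Set.Icc t t' := ⟨le_rfl, htt.le⟩
  have hr : t' ∈ Set.Icc t t' := ⟨htt.le, le_rfl⟩
  have hcs := Real.cosh_sq (t' - t)
  set D := t' - t with hD
  have h1 : lor (γ t').vec (γ t).vec = -Real.cosh D := by linarith [hγ t' hr t hl]
  obtain ⟨v, hv⟩ : ∃ v, v = (Real.sinh D)⁻¹ • ((γ t').vec - Real.cosh D • (γ t).vec) := ⟨_, rfl⟩
  have hv0 : lor (γ t).vec v = 0 := by
    rw [hv, lor_smul_right, lor_sub_right, lor_smul_right, (γ t).lor_self, lor_comm, h1]; ring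
  have hv1 : lor v v = 1 := by
    rw [hv]
    simp only [lor_smul_right, lor_smul_left, lor_sub_left, lor_sub_right, (γ t).lor_self,
      (γ t').lor_self, lor_comm (γ t).vec (γ t').vec, h1]
    field_simp
    linarith
  refine ⟨v, hv0, hv1, fun u hu => ?_⟩
  have g1 : lor (γ u).vec (γ t).vec = -Real.cosh (u - t) := by linarith [hγ u hu t hl]
  have g2 : lor (γ u).vec v = Real.sinh (u - t) := by
    have g3 : lor (γ u).vec (γ t').vec = -Real.cosh (u - t') := by linarith [hγ u hu t' hr]
    rw [hv, lor_smul_right, lor_sub_right, lor_smul_right, g1, g3,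
      show u - t' = (u - t) - D by ring, Real.cosh_sub]
    field_simp
    ring
  have hu2 := Real.cosh_sq (u - t)
  have hw := (lor_self_of_orth (γ t)
    (x := (γ u).vec - (Real.cosh (u - t) • (γ t).vec + Real.sinh (u - t) • v)) (by
      simp only [lor_sub_right, lor_add_right, lor_smul_right, (γ t).lor_self, hv0,
        lor_comm (γ t).vec (γ u).vec, g1]
      ring)).2 (by
      simp only [lor_sub_right, lor_sub_left, lor_add_right, lor_add_left, lor_smul_right,
        lor_smul_left, (γ t).lor_self, (γ u).lor_self, hv0, hv1, lor_comm (γ t).vec (γ u).vec,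
        lor_comm v, g1, g2]
      linarith)
  exact sub_eq_zero.1 hw

theorem exists_gap {T : Set ℝ} (hT : ∀ a b : ℝ, (T ∩ Set.Icc a b).Finite) (t : ℝ) :
    ∃ ε > 0, Disjoint (Set.Ioo (t - ε) t) T ∧ Disjoint (Set.Ioo t (t + ε)) T := by
  have hfin : ((T ∩ Set.Icc (t - 1) (t + 1)) \ {t}).Finite := (hT _ _).sdiff
  have hmem : ((T ∩ Set.Icc (t - 1) (t + 1)) \ {t})ᶜ ∈ nhds t :=
    hfin.isClosed.isOpen_compl.mem_nhds (by simp)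
  obtain ⟨ε, hε, hsub⟩ := Metric.mem_nhds_iff.1 hmem
  refine ⟨min ε 1, lt_min hε one_pos, ?_, ?_⟩ <;>
  · rw [Set.disjoint_left]
    intro u hu huT
    have h1 := min_le_left ε 1
    have h2 := min_le_right ε 1
    have hball : u ∈ Metric.ball t ε := by
      rw [Metric.mem_ball, Real.dist_eq, abs_lt]
      constructor <;> linarith [hu.1, hu.2]
    refine hsub hball ⟨⟨huT, ?_, ?_⟩, ?_⟩
    · linarith [hu.1, hu.2]
    · linarith [hu.1, hu.2]
    · intro h
      rw [Set.mem_singleton_iff] at h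
      linarith [hu.1, hu.2]

/-- The left velocity of a path. -/
noncomputable def velL {n : ℕ} (γ : ℝ → Hyp n) (t : ℝ) : Fin (n + 1) → ℝ :=
  derivWithin (fun s => (γ s).vec) (Set.Iic t) t

/-- The right velocity of a path. -/
noncomputable def velR {n : ℕ} (γ : ℝ → Hyp n) (t : ℝ) : Fin (n + 1) → ℝ :=
  derivWithin (fun s => (γ s).vec) (Set.Ici t) t

theorem bendAngle_eq {n : ℕ} (γ : ℝ → Hyp n) (t : ℝ) :
    bendAngle γ t = Real.arccos (lor (velL γ t) (velR γ t)) := rfl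

theorem bendAngle_nonneg {n : ℕ} (γ : ℝ → Hyp n) (t : ℝ) : 0 ≤ bendAngle γ t :=
  Real.arccos_nonneg _

section Path

variable {n : ℕ} {γ : ℝ → Hyp n} {T : Set ℝ}

theorem segment_formula (hc : Continuous γ)
    (hγ : ∀ a b : ℝ, Disjoint (Set.Ioo a b) T →
      ∀ s ∈ Set.Ioo a b, ∀ t ∈ Set.Ioo a b, hdist (γ s) (γ t) = |s - t|)
    {t t' : ℝ} (htt : t < t') (hd : Disjoint (Set.Ioo t t') T) :
    lor (γ t).vec (velR γ t) = 0 ∧ lor (velR γ t) (velR γ t) = 1 ∧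
    lor (γ t').vec (velL γ t') = 0 ∧ lor (velL γ t') (velL γ t') = 1 ∧
    (γ t').vec = Real.cosh (t' - t) • (γ t).vec + Real.sinh (t' - t) • velR γ t ∧
    velL γ t' = Real.sinh (t' - t) • (γ t).vec + Real.cosh (t' - t) • velR γ t := by
  have hvec : Continuous fun u => (γ u).vec := Hyp.continuous_vec.comp hc
  have hclosed : ∀ s ∈ Set.Icc t t', ∀ u ∈ Set.Icc t t',
      -lor (γ s).vec (γ u).vec = Real.cosh (s - u) := by
    have heq : Set.EqOn (fun q : ℝ × ℝ => -lor (γ q.1).vec (γ q.2).vec)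
        (fun q : ℝ × ℝ => Real.cosh (q.1 - q.2)) (Set.Ioo t t' ×ˢ Set.Ioo t t') := by
      rintro ⟨s, u⟩ ⟨hs, hu⟩
      simp only
      rw [← cosh_hdist, hγ t t' hd s hs u hu, Real.cosh_abs]
    have h1 : Continuous fun q : ℝ × ℝ => -lor (γ q.1).vec (γ q.2).vec := by
      have g1 := hvec.comp continuous_fst (X := ℝ × ℝ)
      have g2 := hvec.comp continuous_snd (X := ℝ × ℝ)
      have g1' := fun i => (continuous_apply i).comp g1
      have g2' := fun i => (continuous_apply i).comp g2
      simp only [Function.comp_def] at g1' g2'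
      unfold lor
      exact ((((g1' 0).mul (g2' 0)).neg).add
        (continuous_finsetSum _ fun i _ => (g1' _).mul (g2' _))).neg
    have h2 : Continuous fun q : ℝ × ℝ => Real.cosh (q.1 - q.2) := by fun_prop
    have hcl := heq.closure h1 h2
    rw [closure_prod_eq, closure_Ioo htt.ne] at hcl
    exact fun s hs u hu => hcl (Set.mk_mem_prod hs hu)
  obtain ⟨v, h0, h1, hf⟩ := exists_geodesic_formula htt hclosed
  obtain ⟨d1, d2⟩ := derivWithin_of_eqOn (f := fun u => (γ u).vec) t htt hf
  have hR : velR γ t = v := by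
    rw [velR, d1, sub_self, Real.sinh_zero, Real.cosh_zero, zero_smul, one_smul, zero_add]
  have hLe : velL γ t' = Real.sinh (t' - t) • (γ t).vec + Real.cosh (t' - t) • v := d2
  have hcs := Real.cosh_sq (t' - t)
  rw [hR]
  refine ⟨h0, h1, ?_, ?_, hf t' ⟨htt.le, le_rfl⟩, hLe⟩
  · rw [hLe, hf t' ⟨htt.le, le_rfl⟩]
    simp only [lor_add_left, lor_add_right, lor_smul_left, lor_smul_right, (γ t).lor_self, h0, h1,
      lor_comm v]
    ring
  · rw [hLe]
    simp only [lor_add_left, lor_add_right, lor_smul_left, lor_smul_right, (γ t).lor_self, h0, h1,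
      lor_comm v]
    linarith

/-- The radial data of a piecewise geodesic, as seen from any base point. -/
theorem radialProfile (hc : Continuous γ) (hT : ∀ a b : ℝ, (T ∩ Set.Icc a b).Finite)
    (hγ : ∀ a b : ℝ, Disjoint (Set.Ioo a b) T →
      ∀ s ∈ Set.Ioo a b, ∀ t ∈ Set.Ioo a b, hdist (γ s) (γ t) = |s - t|) (p : Hyp n) :
    RadialProfile T (bendAngle γ) (fun t => -lor p.vec (γ t).vec) (fun t => -lor p.vec (velL γ t))
      (fun t => -lor p.vec (velR γ t)) := by
  refine ⟨hT, fun t u htu hd => ?_, fun t => ?_, fun t => one_le_neg_lor p (γ t)⟩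
  · obtain ⟨-, -, -, -, h1, h2⟩ := segment_formula hc hγ htu hd
    simp only [h1, h2, lor_add_right, lor_smul_right]
    constructor <;> ring
  · obtain ⟨ε, hε, hl, hr⟩ := exists_gap hT t
    obtain ⟨R0, R1, -, -, -, -⟩ := segment_formula hc hγ (by linarith : t < t + ε) hr
    obtain ⟨-, -, L0, L1, -, -⟩ := segment_formula hc hγ (by linarith : t - ε < t) hl
    obtain ⟨y0, y1⟩ := lor_self_add_smul p (γ t)
    set y := p.vec + lor p.vec (γ t).vec • (γ t).vec with hy
    have hpy : ∀ v, lor (γ t).vec v = 0 → lor p.vec v = lor y v := by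
      intro v hv
      rw [hy, lor_add_left, lor_smul_left, hv, mul_zero, add_zero]
    simp only [neg_sq]
    rw [← y1, hpy _ R0, hpy _ L0]
    have hyn := (lor_self_of_orth (γ t) y0).1
    rcases hyn.eq_or_lt with h0 | h0
    · have hz := (lor_self_of_orth (γ t) y0).2 h0.symm
      refine ⟨0, ⟨le_rfl, Real.pi_pos.le⟩, 0, ⟨le_rfl, Real.pi_pos.le⟩, ?_, ?_, ?_⟩
      · rw [← h0, hz]; simp [lor]
      · rw [← h0, hz]; simp [lor]
      · rw [sub_self, abs_zero]; exact Real.arccos_nonneg _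
    · have hS := Real.sqrt_pos.2 h0
      have hS2 := Real.sq_sqrt hyn
      set S := √(lor y y) with hSdef
      obtain ⟨u, hu⟩ : ∃ u, u = -(S⁻¹ • y) := ⟨_, rfl⟩
      have u0 : lor (γ t).vec u = 0 := by
        rw [hu, lor_neg_right, lor_smul_right, y0]; ring
      have u1 : lor u u = 1 := by
        rw [hu]
        simp only [lor_neg_right, lor_neg_left, lor_smul_right, lor_smul_left]
        rw [← hS2]
        field_simp
      have huv : ∀ v, -lor y v = S * lor u v := by
        intro v
        rw [hu, lor_neg_left, lor_smul_left]
        field_simp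
      have hcos : ∀ v, lor (γ t).vec v = 0 → lor v v = 1 →
          -lor y v = S * Real.cos (Real.arccos (lor u v)) := by
        intro v h1 h2
        have := abs_le.1 (abs_lor_le_one (γ t) u0 h1 u1 h2)
        rw [Real.cos_arccos this.1 this.2, huv]
      refine ⟨_, ⟨Real.arccos_nonneg _, Real.arccos_le_pi _⟩, _,
        ⟨Real.arccos_nonneg _, Real.arccos_le_pi _⟩, hcos _ L0 L1, hcos _ R0 R1, ?_⟩
      have t1 := arccos_lor_triangle (γ t) u0 L0 R0 u1 L1 R1
      have t2 := arccos_lor_triangle (γ t) u0 R0 L0 u1 R1 L1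
      rw [lor_comm (velR γ t)] at t2
      rw [bendAngle_eq, abs_le]
      constructor <;> linarith

theorem sum_bendAngle_le {L b a : ℝ} (hb : pathRoundness L γ ≤ ENNReal.ofReal b) (hb0 : 0 ≤ b)
    (F : Finset ℝ) (hF : ∀ u ∈ F, a < u ∧ u < a + L) : ∑ u ∈ F, bendAngle γ u ≤ b := by
  have h1 : ∑' t : Set.Ioo a (a + L), ENNReal.ofReal (bendAngle γ t) ≤ ENNReal.ofReal b :=
    (le_iSup (fun a : ℝ => ∑' t : Set.Ioo a (a + L), ENNReal.ofReal (bendAngle γ t)) a).trans hb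
  rw [tsum_subtype (Set.Ioo a (a + L)) fun t => ENNReal.ofReal (bendAngle γ t)] at h1
  have h2 := (ENNReal.sum_le_tsum F).trans h1
  rw [Finset.sum_congr rfl fun u hu => Set.indicator_of_mem
    (show u ∈ Set.Ioo a (a + L) from hF u hu) _,
    ← ENNReal.ofReal_sum_of_nonneg fun u _ => bendAngle_nonneg γ u,
    ENNReal.ofReal_le_ofReal_iff hb0] at h2
  exact h2

end Path

/-- A piecewise geodesic with `‖γ‖_L ≤ b < G(L)` is bilipschitz, with constants depending only on
`L` and `b`. -/
theorem IsPiecewiseGeodesic.hdist_bounds {n : ℕ} {γ : ℝ → Hyp n} (h : IsPiecewiseGeodesic γ)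
    {L b : ℝ} (hL : 0 < L) (hb0 : 0 ≤ b) (hbG : b < hillG L)
    (hb : pathRoundness L γ ≤ ENNReal.ofReal b) (s t : ℝ) :
    lowerConst L b * |s - t| ≤ hdist (γ s) (γ t) ∧ hdist (γ s) (γ t) ≤ |s - t| := by
  obtain ⟨hc, T, hT, hγ⟩ := h
  wlog hst : s ≤ t generalizing s t
  · rw [hdist_comm, abs_sub_comm]
    exact this t s (le_of_not_ge hst)
  rw [abs_sub_comm, abs_of_nonneg (sub_nonneg.2 hst)]
  exact (radialProfile hc hT hγ (γ s)).dist_bounds hL hb0 hbG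
    (fun a F hF => sum_bendAngle_le hb hb0 F hF) (by simp [(γ s).lor_self]) hst (hdist_nonneg _ _)
    (cosh_hdist _ _)

/-! ### Geodesics of the hyperbolic plane and the leaves they cross -/

section Line

variable {n : ℕ}

theorem Hyp.vec_of_lor {x : Fin (n + 1) → ℝ} (q : Hyp n) (hx : lor x x = -1)
    (hq : lor x q.vec < 0) : 0 < x 0 := by
  by_contra hneg
  push Not at hneg
  rcases hneg.eq_or_lt with h0 | h0
  · have : 0 ≤ lor x x := by
      rw [lor, h0, mul_zero, neg_zero, zero_add]
      exact Finset.sum_nonneg fun i _ => mul_self_nonneg _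
    linarith
  · have := one_le_neg_lor (⟨-x, by rw [lor_neg_left, lor_neg_right, hx]; ring,
      by simpa using h0⟩ : Hyp n) q
    rw [show (Hyp.vec ⟨-x, _⟩ : Fin (n + 1) → ℝ) = -x from rfl, lor_neg_left] at this
    linarith

/-- The geodesic line through `p` with unit tangent vector `v`. -/
noncomputable def hypLine (p : Hyp n) {v : Fin (n + 1) → ℝ} (h0 : lor p.vec v = 0)
    (h1 : lor v v = 1) (t : ℝ) : Hyp n :=
  ⟨Real.cosh t • p.vec + Real.sinh t • v, by
    have h : lor (Real.cosh t • p.vec + Real.sinh t • v) (Real.cosh t • p.vec + Real.sinh t • v)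
        = -1 := by
      simp only [lor_add_left, lor_add_right, lor_smul_left, lor_smul_right, p.lor_self, h0, h1,
        lor_comm v]
      linarith [Real.cosh_sq t]
    refine ⟨h, Hyp.vec_of_lor p h ?_⟩
    rw [lor_add_left, lor_smul_left, lor_smul_left, p.lor_self, lor_comm v, h0]
    linarith [Real.cosh_pos t]⟩

variable {p : Hyp n} {v : Fin (n + 1) → ℝ} {h0 : lor p.vec v = 0} {h1 : lor v v = 1}

theorem hypLine_vec (t : ℝ) :
    (hypLine p h0 h1 t).vec = Real.cosh t • p.vec + Real.sinh t • v := rfl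

theorem hypLine_zero : hypLine p h0 h1 0 = p :=
  Hyp.ext_vec (by simp [hypLine_vec])

theorem isGeodesicLine_hypLine (a : ℝ) : IsGeodesicLine fun t => hypLine p h0 h1 (a + t) := by
  intro s t
  have h : -lor (hypLine p h0 h1 (a + s)).vec (hypLine p h0 h1 (a + t)).vec
      = Real.cosh |s - t| := by
    rw [Real.cosh_abs, show s - t = (a + s) - (a + t) by ring, Real.cosh_sub]
    simp only [hypLine_vec, lor_add_left, lor_add_right, lor_smul_left, lor_smul_right, p.lor_self,
      h0, h1, lor_comm v]
    ring
  rw [hdist, h, Real.arcosh_cosh (abs_nonneg _)]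

theorem hdist_hypLine (s t : ℝ) : hdist (hypLine p h0 h1 s) (hypLine p h0 h1 t) = |s - t| := by
  simpa using isGeodesicLine_hypLine (h0 := h0) (h1 := h1) 0 s t

theorem eq_of_hdist_eq_zero {p q : Hyp n} (h : hdist p q = 0) : p = q := by
  have hc := cosh_hdist p q
  rw [h, Real.cosh_zero] at hc
  have hl : lor p.vec q.vec = -1 := by linarith
  obtain ⟨y0, y1⟩ := lor_self_add_smul p q
  have := (lor_self_of_orth q y0).2 (by rw [y1, hl]; norm_num)
  rw [hl, neg_one_smul, ← sub_eq_add_neg] at this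
  exact Hyp.ext_vec (sub_eq_zero.1 this)

theorem exists_hypLine {p q : Hyp n} (hpq : p ≠ q) :
    ∃ v, ∃ h0 : lor p.vec v = 0, ∃ h1 : lor v v = 1, hypLine p h0 h1 (hdist p q) = q := by
  have hd : 0 < hdist p q :=
    lt_of_le_of_ne (hdist_nonneg p q) fun h => hpq (eq_of_hdist_eq_zero h.symm)
  have hs := Real.sinh_pos_iff.2 hd
  have hc := cosh_hdist p q
  have hsq := Real.cosh_sq (hdist p q)
  set d := hdist p q
  have hl : lor p.vec q.vec = -Real.cosh d := by linarith
  refine ⟨(Real.sinh d)⁻¹ • (q.vec - Real.cosh d • p.vec), ?_, ?_, Hyp.ext_vec ?_⟩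
  · rw [lor_smul_right, lor_sub_right, lor_smul_right, p.lor_self, hl]; ring
  · simp only [lor_smul_right, lor_smul_left, lor_sub_left, lor_sub_right, p.lor_self, q.lor_self,
      lor_comm q.vec p.vec, hl]
    field_simp
    linarith
  · rw [hypLine_vec, smul_smul, mul_inv_cancel₀ hs.ne', one_smul, add_sub_cancel]

/-- The tangent vector of `hypLine`. -/
noncomputable def lineVel (p : Hyp n) (v : Fin (n + 1) → ℝ) (t : ℝ) : Fin (n + 1) → ℝ :=
  Real.sinh t • p.vec + Real.cosh t • v

theorem lor_hypLine_lineVel (t : ℝ) : lor (hypLine p h0 h1 t).vec (lineVel p v t) = 0 := by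
  simp only [hypLine_vec, lineVel, lor_add_left, lor_add_right, lor_smul_left, lor_smul_right,
    p.lor_self, h0, h1, lor_comm v]
  ring

theorem lor_lineVel_self (h0 : lor p.vec v = 0) (h1 : lor v v = 1) (t : ℝ) :
    lor (lineVel p v t) (lineVel p v t) = 1 := by
  simp only [lineVel, lor_add_left, lor_add_right, lor_smul_left, lor_smul_right, p.lor_self, h0,
    h1, lor_comm v]
  linarith [Real.cosh_sq t]

theorem lor_hypLine_eq (w : Fin (n + 1) → ℝ) (t u : ℝ) :
    lor (hypLine p h0 h1 u).vec w = Real.cosh (u - t) * lor (hypLine p h0 h1 t).vec w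
      + Real.sinh (u - t) * lor (lineVel p v t) w := by
  simp only [hypLine_vec, lineVel, lor_add_left, lor_smul_left, Real.cosh_sub, Real.sinh_sub]
  linear_combination (-(Real.cosh u * lor p.vec w + Real.sinh u * lor v w)) * Real.cosh_sq t

theorem continuous_lor_hypLine (w : Fin (n + 1) → ℝ) :
    Continuous fun t => lor (hypLine p h0 h1 t).vec w := by
  simp only [hypLine_vec, lor_add_left, lor_smul_left]
  fun_prop

end Line

section Crossing

variable {μ : FiniteLamination} {p : Hyp 2} {v : Fin 3 → ℝ} {h0 : lor p.vec v = 0}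
  {h1 : lor v v = 1}

/-- The times at which a geodesic crosses a leaf. -/
def crossings (μ : FiniteLamination) (α : ℝ → Hyp 2) : Set ℝ := {t | ∃ l ∈ μ.leaves, α t ∈ l}

theorem crossing_unique (hp : ∀ l ∈ μ.leaves, p ∉ l) {l : Set (Hyp 2)} (hl : l ∈ μ.leaves)
    {t u : ℝ} (ht : hypLine p h0 h1 t ∈ l) (hu : hypLine p h0 h1 u ∈ l) : t = u := by
  obtain ⟨w, -, hw⟩ := μ.geodesic l hl
  rw [hw] at ht hu
  rw [lor_hypLine_eq w t u, ht, mul_zero, zero_add] at hu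
  rcases mul_eq_zero.1 hu with h | h
  · linarith [Real.sinh_eq_zero.1 h]
  · refine absurd ?_ (hp l hl)
    rw [hw, ← hypLine_zero (h0 := h0) (h1 := h1), lor_hypLine_eq w t 0, ht, h]
    ring

theorem crossings_finite (hp : ∀ l ∈ μ.leaves, p ∉ l) :
    (crossings μ (hypLine p h0 h1)).Finite := by
  have : crossings μ (hypLine p h0 h1) = ⋃ l ∈ μ.leaves, {t | hypLine p h0 h1 t ∈ l} := by
    ext t; simp [crossings]
  rw [this]
  exact μ.leaves.finite_toSet.biUnion fun l hl =>
    Set.Subsingleton.finite fun t ht u hu => crossing_unique hp hl ht hu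

theorem exists_crossing_of_separates {l : Set (Hyp 2)} {t u : ℝ}
    (h : Separates l (hypLine p h0 h1 t) (hypLine p h0 h1 u)) :
    ∃ s ∈ Set.Ioo (min t u) (max t u), hypLine p h0 h1 s ∈ l := by
  obtain ⟨w, ⟨-, hw⟩, ht, hu⟩ := h
  have hc := continuous_lor_hypLine (h0 := h0) (h1 := h1) w
  rcases lt_trichotomy t u with htu | rfl | htu
  · obtain ⟨s, hs, e⟩ := intermediate_value_Ioo htu.le hc.continuousOn ⟨ht, hu⟩
    exact ⟨s, by rwa [min_eq_left htu.le, max_eq_right htu.le], (hw _).2 e⟩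
  · linarith
  · obtain ⟨s, hs, e⟩ := intermediate_value_Ioo' htu.le hc.continuousOn ⟨ht, hu⟩
    exact ⟨s, by rwa [min_eq_right htu.le, max_eq_left htu.le], (hw _).2 e⟩

theorem not_separates_of_disjoint {a b : ℝ}
    (hd : Disjoint (Set.Ioo a b) (crossings μ (hypLine p h0 h1))) {t u : ℝ}
    (ht : t ∈ Set.Icc a b) (hu : u ∈ Set.Icc a b) {l : Set (Hyp 2)} (hl : l ∈ μ.leaves) :
    ¬ Separates l (hypLine p h0 h1 t) (hypLine p h0 h1 u) := by
  intro h
  obtain ⟨s, hs, hsl⟩ := exists_crossing_of_separates h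
  exact Set.disjoint_left.1 hd
    ⟨(le_min ht.1 hu.1).trans_lt hs.1, hs.2.trans_le (max_le ht.2 hu.2)⟩ ⟨l, hl, hsl⟩

/-- A horocycle meets each of the finitely many leaves finitely often, so some point of it lies on
no leaf. -/
theorem exists_notMem_leaves (μ : FiniteLamination) : ∃ q : Hyp 2, ∀ l ∈ μ.leaves, q ∉ l := by
  let q : ℝ → Hyp 2 := fun s => ⟨![1 + s ^ 2 / 2, s, s ^ 2 / 2], by
    constructor
    · simp [lor, Fin.sum_univ_two]; ring
    · simp; positivity⟩
  have hfin : {s | ∃ l ∈ μ.leaves, q s ∈ l}.Finite := by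
    have : {s | ∃ l ∈ μ.leaves, q s ∈ l} = ⋃ l ∈ μ.leaves, {s | q s ∈ l} := by
      ext s; simp
    rw [this]
    refine μ.leaves.finite_toSet.biUnion fun l hl => ?_
    obtain ⟨w, hw1, hw⟩ := μ.geodesic l hl
    set f : Polynomial ℝ := Polynomial.C ((w 2 - w 0) / 2) * Polynomial.X ^ 2
      + Polynomial.C (w 1) * Polynomial.X + Polynomial.C (-w 0) with hf
    have hf0 : f ≠ 0 := by
      intro h
      have c0 := congrArg (fun f => Polynomial.coeff f 0) h
      have c1 := congrArg (fun f => Polynomial.coeff f 1) h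
      have c2 := congrArg (fun f => Polynomial.coeff f 2) h
      simp [hf, Polynomial.coeff_X, Polynomial.coeff_C] at c0 c1 c2
      have hw2 : w 2 = 0 := by linarith
      simp [lor, Fin.sum_univ_two, c0, c1, hw2] at hw1
    refine (Polynomial.finite_setOfPred_isRoot hf0).subset fun s hs => ?_
    have hs' := (hw _).1 hs
    have hq : (q s).vec = ![1 + s ^ 2 / 2, s, s ^ 2 / 2] := rfl
    rw [hq] at hs'
    simp [lor, Fin.sum_univ_two] at hs'
    simp only [Set.mem_ofPred_eq, Polynomial.IsRoot.def, hf, Polynomial.eval_add,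
      Polynomial.eval_mul, Polynomial.eval_C, Polynomial.eval_pow, Polynomial.eval_X]
    linarith
  obtain ⟨s, hs⟩ := hfin.infinite_compl.nonempty
  exact ⟨q s, fun l hl h => hs ⟨l, hl, h⟩⟩

/-- Points off the leaves are dense. -/
theorem exists_notMem_leaves_near (μ : FiniteLamination) (z : Hyp 2) {ε : ℝ} (hε : 0 < ε) :
    ∃ z' : Hyp 2, (∀ l ∈ μ.leaves, z' ∉ l) ∧ hdist z' z ≤ ε := by
  obtain ⟨q, hq⟩ := exists_notMem_leaves μ
  rcases eq_or_ne q z with rfl | hne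
  · exact ⟨q, hq, by rw [hdist_self]; exact hε.le⟩
  obtain ⟨v, h0, h1, hz⟩ := exists_hypLine hne
  obtain ⟨δ, hδ, hgap, -⟩ := exists_gap (T := crossings μ (hypLine q h0 h1))
    (fun a b => (crossings_finite hq).inter_of_left _) (hdist q z)
  refine ⟨hypLine q h0 h1 (hdist q z - min ε (δ / 2)), fun l hl hmem => ?_, ?_⟩
  · have hm : 0 < min ε (δ / 2) := lt_min hε (by linarith)
    have hm2 := min_le_right ε (δ / 2)
    exact Set.disjoint_left.1 hgap ⟨by linarith, by linarith⟩ ⟨l, hl, hmem⟩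
  · have hm : 0 < min ε (δ / 2) := lt_min hε (by linarith)
    have e := hdist_hypLine (h0 := h0) (h1 := h1) (hdist q z - min ε (δ / 2)) (hdist q z)
    rw [hz] at e
    rw [e, sub_sub_cancel_left, abs_neg, abs_of_pos hm]
    exact min_le_left _ _

end Crossing

/-! ### Pleated planes along geodesics -/

theorem planeIncl_comb (a b : ℝ) (x y : Fin 3 → ℝ) :
    planeIncl (a • x + b • y) = a • planeIncl x + b • planeIncl y := by
  funext i
  fin_cases i <;> simp [planeIncl]

theorem lor_planeIncl (x y : Fin 3 → ℝ) : lor (planeIncl x) (planeIncl y) = lor x y := by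
  simp [lor, planeIncl, Fin.sum_univ_succ]

theorem lor_planeIncl_bend (w : Fin 3 → ℝ) (θ : ℝ) (x : Fin 3 → ℝ) :
    lor (planeIncl x) (bend w θ (planeIncl x))
      = lor x x - (1 - Real.cos θ) * lor x w ^ 2 := by
  have h3 : planeIncl x 3 = 0 := rfl
  have he : lor (planeIncl x) ![0, 0, 0, 1] = 0 := by
    simp [lor, planeIncl, Fin.sum_univ_succ]
  simp only [bend, lor_add_right, lor_smul_right, lor_planeIncl, h3, he]
  ring

/-- Crossing a leaf at an arbitrary angle bends a path by at most the mass of the leaf. -/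
theorem arccos_one_sub_le {θ a : ℝ} (hθ : 0 ≤ θ) (ha : a ^ 2 ≤ 1) :
    Real.arccos (1 - (1 - Real.cos θ) * a ^ 2) ≤ θ := by
  rcases le_or_gt θ Real.pi with h | h
  · rw [← Real.arccos_cos hθ h, Real.cos_arccos (Real.neg_one_le_cos _) (Real.cos_le_one _)]
    apply Real.arccos_le_arccos
    nlinarith [Real.cos_le_one θ]
  · exact (Real.arccos_le_pi _).trans h.le

theorem IsUnitNormal.neg {l : Set (Hyp 2)} {w : Fin 3 → ℝ} (h : IsUnitNormal l w) :
    IsUnitNormal l (-w) :=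
  ⟨by rw [lor_neg_left, lor_neg_right, h.1, neg_neg],
    fun z => by rw [h.2, lor_neg_right, neg_eq_zero]⟩

section Pleated

variable {μ : FiniteLamination} {P : Hyp 2 → Hyp 3} {p : Hyp 2} {v : Fin 3 → ℝ}
  {h0 : lor p.vec v = 0} {h1 : lor v v = 1}
  {A : Hyp 2 → ((Fin 4 → ℝ) →ₗ[ℝ] (Fin 4 → ℝ))}

theorem pleated_vec_eq
    (hP : ∀ z, (∀ l ∈ μ.leaves, z ∉ l) → ∀ z', (∀ l ∈ μ.leaves, ¬ Separates l z z') →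
      (P z').vec = A z (planeIncl z'.vec) ∧ ((∀ l ∈ μ.leaves, z' ∉ l) → A z' = A z))
    {a b : ℝ} (hd : Disjoint (Set.Ioo a b) (crossings μ (hypLine p h0 h1))) {m u : ℝ}
    (hm : m ∈ Set.Ioo a b) (hu : u ∈ Set.Icc a b) :
    (P (hypLine p h0 h1 u)).vec
        = A (hypLine p h0 h1 m) (planeIncl (hypLine p h0 h1 u).vec) ∧
      ((∀ l ∈ μ.leaves, hypLine p h0 h1 u ∉ l) →
        A (hypLine p h0 h1 u) = A (hypLine p h0 h1 m)) :=
  hP _ (fun l hl hml => Set.disjoint_left.1 hd hm ⟨l, hl, hml⟩) _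
    fun _ hl => not_separates_of_disjoint hd (Set.Ioo_subset_Icc_self hm) hu hl

theorem pleated_vec_eq_comb
    (hP : ∀ z, (∀ l ∈ μ.leaves, z ∉ l) → ∀ z', (∀ l ∈ μ.leaves, ¬ Separates l z z') →
      (P z').vec = A z (planeIncl z'.vec) ∧ ((∀ l ∈ μ.leaves, z' ∉ l) → A z' = A z))
    {a b : ℝ} (hd : Disjoint (Set.Ioo a b) (crossings μ (hypLine p h0 h1))) {m u : ℝ}
    (hm : m ∈ Set.Ioo a b) (hu : u ∈ Set.Icc a b) :
    (P (hypLine p h0 h1 u)).vec = Real.cosh (u - 0) • A (hypLine p h0 h1 m) (planeIncl p.vec)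
      + Real.sinh (u - 0) • A (hypLine p h0 h1 m) (planeIncl v) := by
  rw [(pleated_vec_eq hP hd hm hu).1, hypLine_vec, planeIncl_comb, map_add, map_smul, map_smul,
    sub_zero]

theorem isPiecewiseGeodesic_pleated (hp : ∀ l ∈ μ.leaves, p ∉ l)
    (hA : ∀ z, ∀ x y, lor (A z x) (A z y) = lor x y)
    (hP : ∀ z, (∀ l ∈ μ.leaves, z ∉ l) → ∀ z', (∀ l ∈ μ.leaves, ¬ Separates l z z') →
      (P z').vec = A z (planeIncl z'.vec) ∧ ((∀ l ∈ μ.leaves, z' ∉ l) → A z' = A z)) :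
    IsPiecewiseGeodesic fun t => P (hypLine p h0 h1 t) := by
  have hfin : ∀ a b : ℝ, (crossings μ (hypLine p h0 h1) ∩ Set.Icc a b).Finite := fun a b =>
    (crossings_finite hp).inter_of_left _
  refine ⟨?_, crossings μ (hypLine p h0 h1), hfin, fun a b hd s hs t ht => ?_⟩
  · refine continuous_induced_rng.2 (continuous_iff_continuousAt.2 fun t => ?_)
    obtain ⟨ε, hε, hl, hr⟩ := exists_gap hfin t
    have hcont : ∀ m, Continuous fun u : ℝ =>
        Real.cosh (u - 0) • A (hypLine p h0 h1 m) (planeIncl p.vec)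
          + Real.sinh (u - 0) • A (hypLine p h0 h1 m) (planeIncl v) := fun m => by fun_prop
    rw [continuousAt_iff_continuous_left_right]
    constructor
    · refine (hcont (t - ε / 2)).continuousWithinAt.congr_of_eventuallyEq ?_
        (pleated_vec_eq_comb hP hl ⟨by linarith, by linarith⟩ ⟨by linarith, le_rfl⟩)
      filter_upwards [Icc_mem_nhdsLE (by linarith : t - ε < t)] with u hu
      exact pleated_vec_eq_comb hP hl ⟨by linarith, by linarith⟩ hu
    · refine (hcont (t + ε / 2)).continuousWithinAt.congr_of_eventuallyEq ?_
        (pleated_vec_eq_comb hP hr ⟨by linarith, by linarith⟩ ⟨le_rfl, by linarith⟩)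
      filter_upwards [Icc_mem_nhdsGE (by linarith : t < t + ε)] with u hu
      exact pleated_vec_eq_comb hP hr ⟨by linarith, by linarith⟩ hu
  · rw [← hdist_hypLine (h0 := h0) (h1 := h1), hdist, hdist,
      (pleated_vec_eq hP hd hs (Set.Ioo_subset_Icc_self ht)).1,
      (pleated_vec_eq hP hd hs (Set.Ioo_subset_Icc_self hs)).1, hA, lor_planeIncl]

/-- A geodesic is bent by a pleated plane only where it crosses a leaf, and there by at most the
mass of that leaf. -/
theorem bendAngle_pleated_le (hp : ∀ l ∈ μ.leaves, p ∉ l)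
    (hA : ∀ z, ∀ x y, lor (A z x) (A z y) = lor x y)
    (hP : ∀ z, (∀ l ∈ μ.leaves, z ∉ l) → ∀ z', (∀ l ∈ μ.leaves, ¬ Separates l z z') →
      (P z').vec = A z (planeIncl z'.vec) ∧ ((∀ l ∈ μ.leaves, z' ∉ l) → A z' = A z))
    (hB : ∀ z z', (∀ l ∈ μ.leaves, z ∉ l) → (∀ l ∈ μ.leaves, z' ∉ l) →
      ∀ l ∈ μ.leaves, (∀ l' ∈ μ.leaves, l' ≠ l → ¬ Separates l' z z') →
        ∀ w, IsUnitNormal l w → lor z.vec w < 0 → 0 < lor z'.vec w →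
          ∀ x, A z' x = A z (bend w (μ.mass l) x)) (t : ℝ) :
    (∀ l ∈ μ.leaves, hypLine p h0 h1 t ∈ l →
      bendAngle (fun t => P (hypLine p h0 h1 t)) t ≤ μ.mass l) ∧
    ((∀ l ∈ μ.leaves, hypLine p h0 h1 t ∉ l) →
      bendAngle (fun t => P (hypLine p h0 h1 t)) t = 0) := by
  obtain ⟨ε, hε, hl, hr⟩ := exists_gap (T := crossings μ (hypLine p h0 h1))
    (fun a b => (crossings_finite hp).inter_of_left _) t
  have ml : t - ε / 2 ∈ Set.Ioo (t - ε) t := ⟨by linarith, by linarith⟩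
  have mr : t + ε / 2 ∈ Set.Ioo t (t + ε) := ⟨by linarith, by linarith⟩
  have offl : ∀ l ∈ μ.leaves, hypLine p h0 h1 (t - ε / 2) ∉ l := fun l hl' hmem =>
    Set.disjoint_left.1 hl ml ⟨l, hl', hmem⟩
  have offr : ∀ l ∈ μ.leaves, hypLine p h0 h1 (t + ε / 2) ∉ l := fun l hl' hmem =>
    Set.disjoint_left.1 hr mr ⟨l, hl', hmem⟩
  have hL := (derivWithin_of_eqOn (f := fun u => (P (hypLine p h0 h1 u)).vec) 0
    (by linarith : t - ε < t) fun u hu => pleated_vec_eq_comb hP hl ml hu).2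
  have hR := (derivWithin_of_eqOn (f := fun u => (P (hypLine p h0 h1 u)).vec) 0
    (by linarith : t < t + ε) fun u hu => pleated_vec_eq_comb hP hr mr hu).1
  rw [sub_zero, ← map_smul, ← map_smul, ← map_add, ← planeIncl_comb] at hL hR
  have hbend : bendAngle (fun t => P (hypLine p h0 h1 t)) t
      = Real.arccos (lor (A (hypLine p h0 h1 (t - ε / 2)) (planeIncl (lineVel p v t)))
          (A (hypLine p h0 h1 (t + ε / 2)) (planeIncl (lineVel p v t)))) := by
    rw [bendAngle, hL, hR]; rfl
  have hv := lor_lineVel_self h0 h1 t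
  refine ⟨fun l hlμ hmem => ?_, fun hoff => ?_⟩
  · obtain ⟨w, hw0, hcross⟩ : ∃ w, IsUnitNormal l w ∧ 0 < lor (lineVel p v t) w := by
      obtain ⟨w, hw⟩ := μ.geodesic l hlμ
      have hne : lor (lineVel p v t) w ≠ 0 := by
        intro h
        refine offr l hlμ ((hw.2 _).2 ?_)
        rw [lor_hypLine_eq w t, (hw.2 _).1 hmem, h]
        ring
      rcases hne.lt_or_gt with h | h
      · exact ⟨-w, hw.neg, by rw [lor_neg_right]; linarith⟩
      · exact ⟨w, hw, h⟩
    have hz := (hw0.2 _).1 hmem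
    have hneg : lor (hypLine p h0 h1 (t - ε / 2)).vec w < 0 := by
      rw [lor_hypLine_eq w t, hz, mul_zero, zero_add]
      exact mul_neg_of_neg_of_pos (Real.sinh_neg_iff.2 (by linarith)) hcross
    have hpos : 0 < lor (hypLine p h0 h1 (t + ε / 2)).vec w := by
      rw [lor_hypLine_eq w t, hz, mul_zero, zero_add]
      exact mul_pos (Real.sinh_pos_iff.2 (by linarith)) hcross
    have hsep : ∀ l' ∈ μ.leaves, l' ≠ l →
        ¬ Separates l' (hypLine p h0 h1 (t - ε / 2)) (hypLine p h0 h1 (t + ε / 2)) := by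
      intro l' hl' hne hs
      obtain ⟨u, hu, hmem'⟩ := exists_crossing_of_separates hs
      rw [min_eq_left (by linarith), max_eq_right (by linarith)] at hu
      rcases lt_trichotomy u t with h | rfl | h
      · exact Set.disjoint_left.1 hl ⟨by linarith [hu.1], h⟩ ⟨l', hl', hmem'⟩
      · exact Set.disjoint_left.1 (μ.disjoint l' hl' l hlμ hne) hmem' hmem
      · exact Set.disjoint_left.1 hr ⟨h, by linarith [hu.2]⟩ ⟨l', hl', hmem'⟩
    rw [hbend, hB _ _ offl offr l hlμ hsep w hw0 hneg hpos, hA, lor_planeIncl_bend, hv]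
    refine arccos_one_sub_le (μ.mass_pos l hlμ).le ?_
    -- `w` is tangent to the plane at the crossing point.
    have := lor_sq_le_of_orth (hypLine p h0 h1 t) (lor_hypLine_lineVel t) hz
    rwa [hv, hw0.1, one_mul] at this
  · have hd : Disjoint (Set.Ioo (t - ε) (t + ε)) (crossings μ (hypLine p h0 h1)) := by
      rw [Set.disjoint_left]
      intro u hu hT
      rcases lt_trichotomy u t with h | rfl | h
      · exact Set.disjoint_left.1 hl ⟨hu.1, h⟩ hT
      · obtain ⟨l, hl', hmem⟩ := hT
        exact hoff l hl' hmem
      · exact Set.disjoint_left.1 hr ⟨h, hu.2⟩ hT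
    rw [hbend, (pleated_vec_eq hP hd (m := t - ε / 2) (u := t + ε / 2)
      ⟨by linarith, by linarith⟩ ⟨by linarith, by linarith⟩).2 offr, hA, lor_planeIncl, hv,
      Real.arccos_one]

/-- The image of a geodesic under a pleated plane is at most as bent as the plane. -/
theorem pathRoundness_pleated_le {L : ℝ} (hL : 0 < L) (hp : ∀ l ∈ μ.leaves, p ∉ l)
    (hb : ∀ t, (∀ l ∈ μ.leaves, hypLine p h0 h1 t ∈ l →
      bendAngle (fun t => P (hypLine p h0 h1 t)) t ≤ μ.mass l) ∧
    ((∀ l ∈ μ.leaves, hypLine p h0 h1 t ∉ l) →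
      bendAngle (fun t => P (hypLine p h0 h1 t)) t = 0)) :
    pathRoundness L (fun t => P (hypLine p h0 h1 t)) ≤ μ.roundness L := by
  classical
  refine iSup_le fun a => le_trans ?_
    (le_iSup₂ (f := fun (α : ℝ → Hyp 2) (_ : IsGeodesicLine α) => μ.inter (α '' Set.Ioo 0 L))
      (fun t => hypLine p h0 h1 (a + t)) (isGeodesicLine_hypLine a))
  have hmem : ∀ t : Set.Ioo a (a + L), hypLine p h0 h1 t
      ∈ (fun t => hypLine p h0 h1 (a + t)) '' Set.Ioo 0 L := fun t =>
    ⟨t - a, ⟨by linarith [t.2.1], by linarith [t.2.2]⟩, by simp⟩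
  calc ∑' t : Set.Ioo a (a + L),
        ENNReal.ofReal (bendAngle (fun t => P (hypLine p h0 h1 t)) t)
      ≤ ∑' t : Set.Ioo a (a + L), ∑ l ∈ μ.leaves,
          if hypLine p h0 h1 t ∈ l then ENNReal.ofReal (μ.mass l) else 0 := by
        refine ENNReal.tsum_le_tsum fun t => ?_
        by_cases h : ∃ l ∈ μ.leaves, hypLine p h0 h1 t ∈ l
        · obtain ⟨l, hl, hm⟩ := h
          refine le_trans (ENNReal.ofReal_le_ofReal ((hb t).1 l hl hm)) ?_
          refine le_trans (le_of_eq (if_pos hm).symm)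
            (Finset.single_le_sum (f := fun l => if hypLine p h0 h1 t ∈ l then
              ENNReal.ofReal (μ.mass l) else 0) (fun _ _ => zero_le) hl)
        · push Not at h
          rw [(hb t).2 h, ENNReal.ofReal_zero]
          exact zero_le
    _ = ∑ l ∈ μ.leaves, ∑' t : Set.Ioo a (a + L),
          if hypLine p h0 h1 t ∈ l then ENNReal.ofReal (μ.mass l) else 0 :=
        Summable.tsum_finsetSum fun _ _ => ENNReal.summable
    _ ≤ μ.inter ((fun t => hypLine p h0 h1 (a + t)) '' Set.Ioo 0 L) := by
        refine Finset.sum_le_sum fun l hl => ?_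
        by_cases h : ∃ t : Set.Ioo a (a + L), hypLine p h0 h1 t ∈ l
        · obtain ⟨t, ht⟩ := h
          rw [tsum_eq_single t fun u hu => if_neg fun hul =>
            hu (Subtype.ext (crossing_unique hp hl hul ht)), if_pos ht, if_pos]
          refine ⟨⟨_, ht, hmem t⟩, fun hsub => ?_⟩
          have e := crossing_unique hp hl (hsub (hmem ⟨a + L / 2, by linarith, by linarith⟩))
            (hsub (hmem ⟨a + L / 3, by linarith, by linarith⟩))
          simp only at e
          linarith
        · push Not at h
          rw [ENNReal.tsum_eq_zero.2 fun t => if_neg (h t)]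
          exact zero_le

end Pleated

theorem IsPleatedPlane.hdist_bounds {μ : FiniteLamination} {P : Hyp 2 → Hyp 3}
    (h : IsPleatedPlane μ P) {L b : ℝ} (hL : 0 < L) (hb0 : 0 ≤ b) (hbG : b < hillG L)
    (hb : μ.roundness L ≤ ENNReal.ofReal b) (z z' : Hyp 2) :
    lowerConst L b * hdist z z' ≤ hdist (P z) (P z') ∧ hdist (P z) (P z') ≤ hdist z z' := by
  obtain ⟨A, hA, hP, hB⟩ := h
  have off : ∀ z z' : Hyp 2, (∀ l ∈ μ.leaves, z ∉ l) →
      lowerConst L b * hdist z z' ≤ hdist (P z) (P z') ∧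
        hdist (P z) (P z') ≤ hdist z z' := by
    intro z z' hz
    rcases eq_or_ne z z' with rfl | hne
    · simp [hdist_self]
    obtain ⟨v, h0, h1, hz'⟩ := exists_hypLine hne
    have := (isPiecewiseGeodesic_pleated (h0 := h0) (h1 := h1) hz hA hP).hdist_bounds hL hb0 hbG
      ((pathRoundness_pleated_le hL hz (bendAngle_pleated_le hz hA hP hB)).trans hb)
      0 (hdist z z')
    rwa [hypLine_zero, hz', zero_sub, abs_neg, abs_of_nonneg (hdist_nonneg _ _)] at this
  have hk := lowerConst_pos hL hb0 hbG
  set k := lowerConst L b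
  -- The point `z` may lie on a leaf: approximate it by points off the leaves.
  constructor
  · refine le_of_forall_pos_le_add fun ε hε => ?_
    obtain ⟨y, hy, hyz⟩ := exists_notMem_leaves_near μ z (div_pos hε (by linarith : 0 < 1 + k))
    have h1 := (off y z' hy).1
    have h2 := (off y z hy).2
    have h3 := hdist_triangle z y z'
    have h4 := hdist_triangle (P y) (P z) (P z')
    rw [hdist_comm z y] at h3
    rw [le_div_iff₀ (by linarith)] at hyz
    nlinarith
  · refine le_of_forall_pos_le_add fun ε hε => ?_
    obtain ⟨y, hy, hyz⟩ := exists_notMem_leaves_near μ z (half_pos hε)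
    have h1 := (off y z' hy).2
    have h2 := (off y z hy).2
    have h3 := hdist_triangle y z z'
    have h4 := hdist_triangle (P z) (P y) (P z')
    rw [hdist_comm (P z) (P y)] at h4
    linarith

theorem mainTheorem7 :
    ∃ K : ℝ → ℝ≥0∞ → ℝ,
      (∀ L : ℝ, 0 < L → ∀ γ : ℝ → Hyp 3, IsPiecewiseGeodesic γ →
        pathRoundness L γ < ENNReal.ofReal (hillG L) →
          IsBilipschitz (fun s t : ℝ => |s - t|) (K L (pathRoundness L γ)) γ) ∧
      (∀ L : ℝ, 0 < L → ∀ μ : FiniteLamination,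
        μ.roundness L < ENNReal.ofReal (hillG L) →
          ∀ P : Hyp 2 → Hyp 3, IsPleatedPlane μ P →
            IsBilipschitz hdist (K L (μ.roundness L)) P) := by
  have key : ∀ k d D : ℝ, 0 < k → 0 ≤ d → k * d ≤ D → D ≤ d →
      (max 1 k⁻¹)⁻¹ * d ≤ D ∧ D ≤ max 1 k⁻¹ * d := by
    intro k d D hk hd h1 h2
    constructor
    · refine le_trans (mul_le_mul_of_nonneg_right ?_ hd) h1
      exact inv_le_of_inv_le₀ hk (le_max_right _ _)
    · exact h2.trans (le_mul_of_one_le_left hd (le_max_left _ _))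
  refine ⟨fun L b => max 1 (lowerConst L b.toReal)⁻¹, fun L hL γ hγ hb s t => ?_,
    fun L hL μ hb P hP z z' => ?_⟩
  · have hbG := ENNReal.toReal_lt_of_lt_ofReal hb
    obtain ⟨h1, h2⟩ := hγ.hdist_bounds hL ENNReal.toReal_nonneg hbG
      (ENNReal.ofReal_toReal hb.ne_top).ge s t
    exact key _ _ _ (lowerConst_pos hL ENNReal.toReal_nonneg hbG) (abs_nonneg _) h1 h2
  · have hbG := ENNReal.toReal_lt_of_lt_ofReal hb
    obtain ⟨h1, h2⟩ := hP.hdist_bounds hL ENNReal.toReal_nonneg hbG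
      (ENNReal.ofReal_toReal hb.ne_top).ge z z'
    exact key _ _ _ (lowerConst_pos hL ENNReal.toReal_nonneg hbG) (hdist_nonneg _ _) h1 h2
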